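/- **Theorem (Quantum Cramér–Rao inequalities).** Let $\mathcal H$ be a separable complex Hilbert space and $\Xi$ a separable real Hilbert space, each of finite or infinite dimension. Let $\Theta\subseteq\Xi$ be a set at whose points derivatives relative to $\Theta$ are unique (for example an open set), and let $(\rho(\theta))_{\theta\in\Theta}$ be a family of density operators on $\mathcal H$ with $\rho(\theta)>0$, i.e. $\langle x,\rho(\theta)x\rangle>0$ for $x\ne0$, such that $\rho:\Theta\to\mathcal T(\mathcal H)$ is Fréchet differentiable for the trace norm, with derivative $D_\theta\rho$. Fix $\theta\in\Theta$ and write $\rho=\rho(\theta)$, $(A,B)_{\mathrm{HS}}=\operatorname{Tr}[A^*B]$. *Measurements.* For a POVM $M$ on a measurable space $(\Omega,\mathfrak B)$ (discrete or continuous) let $P^M_\vartheta(B)=\operatorname{Tr}[\rho(\vartheta)M(B)]$. The logarithmic derivative $l_\theta(\cdot\,;\phi)$ is the Radon–Nikodým derivative of $B\mapsto D_\theta P^M_\theta(B)[\phi]$ with respect to $P^M_\theta$, and the Fisher information operator $J^M_\theta$ is the bounded operator on $\Xi$ with $(\phi,J^M_\theta\chi)_\Xi=\int_\Omega l_\theta(x;\phi)\,l_\theta(x;\chi)\,P^M_\theta(dx)$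 for all $\phi,\chi\in\Xi$, the $l_\theta(\cdot\,;\phi)$ being square integrable. *Quantum Fisher information.* The symmetric logarithmic derivative $L^{\mathrm S}(\phi)$ is the symmetric, possibly unbounded, solution of $\tfrac12(\rho L+L\rho)=D_\theta\rho[\phi]$ with finite second moment. Precisely, it is given by the Hilbert–Schmidt operator $A_\phi=L^{\mathrm S}(\phi)\sqrt\rho$ such that $\sqrt\rho A_\phi$ is self-adjoint and $\tfrac12(\sqrt\rho A_\phi^*+A_\phi\sqrt\rho)=D_\theta\rho[\phi]$. The right logarithmic derivative $L^{\mathrm R}(\phi)$ is the solution of $\rho L=D_\theta\rho[\phi]$, given by the Hilbert–Schmidt operator $Y_\phi=\sqrt\rho L^{\mathrm R}(\phi)$ such that $\sqrt\rho Y_\phi=D_\theta\rho[\phi]$. The SLD Fisher information operator $J^{\mathrm S}_\theta$ on $\Xi$ and the RLD Fisher information operator $J^{\mathrm R}_\theta$ on the complexification $\tilde\Xi=\Xi+\mathrm i\,\Xi$ are the bounded operators with $$(\phi,J^{\mathrm S}_\theta\chi)_\Xi=\operatorname{Tr}\big[\tfrac12(\rho L^{\mathrm S}(\phi)+L^{\mathrm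 S}(\phi)\rho)L^{\mathrm S}(\chi)\big]=\operatorname{Re}(A_\phi,A_\chi)_{\mathrm{HS}}\quad(\phi,\chi\in\Xi),$$ $$(\phi,J^{\mathrm R}_\theta\chi)_{\tilde\Xi}=\tilde H(\phi,\chi)\quad(\phi,\chi\in\tilde\Xi),$$ where $\tilde H$ is the sesquilinear extension to $\tilde\Xi$ of $H(\phi,\chi)=\operatorname{Tr}[(\rho L^{\mathrm R}(\phi))^*L^{\mathrm R}(\chi)]=(Y_\phi,Y_\chi)_{\mathrm{HS}}$. 1. If $L^{\mathrm S}(\phi)$ exists for every $\phi\in\Xi$, then $J^{\mathrm S}_\theta$ exists and is unique, and for every POVM $M$ the operator $J^M_\theta$ exists, is unique, and satisfies $J^M_\theta\le J^{\mathrm S}_\theta$. If $L^{\mathrm R}(\phi)$ exists for every $\phi\in\Xi$, then $J^{\mathrm R}_\theta$ exists and is unique, and for every POVM $M$ the operator $J^M_\theta$ exists, is unique, and its complex linear extension to $\tilde\Xi$ satisfies $J^M_\theta\le J^{\mathrm R}_\theta$. 2. If $L^{\mathrm S}(\phi)$ exists for every $\phi\in\Xi$, then for every $\phi\in\Xi$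 $$\max_M\,(\phi,J^M_\theta\phi)_\Xi=(\phi,J^{\mathrm S}_\theta\phi)_\Xi ,$$ where $M$ runs over all POVMs on all measurable spaces, and the maximum is attained. -/

import Mathlib

open MeasureTheory Filter Topology
open scoped InnerProductSpace ENNReal

universe w

noncomputable section


namespace QEst

/-! ### Hilbert–Schmidt and trace class operators -/

section Operators

variable {H : Type*} [NormedAddCommGroup H] [InnerProductSpace ℂ H] [CompleteSpace H]

variable (H) in
/-- Index set of an orthonormal (Hilbert) basis of `H`, fixed once and for all. -/
def basisIndex : Set H := (exists_hilbertBasis ℂ H).choose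

variable (H) in
/-- A fixed orthonormal (Hilbert) basis of `H`. The notions below do not depend on the choice. -/
def stdBasis : HilbertBasis (basisIndex H) ℂ H := (exists_hilbertBasis ℂ H).choose_spec.choose

/-- `A` is a Hilbert–Schmidt operator: `∑ᵢ ‖A eᵢ‖² < ∞`. -/
def IsHilbertSchmidt (A : H →L[ℂ] H) : Prop :=
  Summable fun i => ‖A (stdBasis H i)‖ ^ 2

/-- The Hilbert–Schmidt inner product `(A, B)_HS = Tr[A* B]`, conjugate linear in `A`. -/
def hsInner (A B : H →L[ℂ] H) : ℂ :=
  ∑' i, ⟪A (stdBasis H i), B (stdBasis H i)⟫_ℂ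

/-- The trace norm `‖T‖₁ = Tr √(T* T)`, with value `∞` when `T` is not of trace class. -/
def traceNorm (T : H →L[ℂ] H) : ℝ≥0∞ :=
  ∑' i, ENNReal.ofReal (⟪stdBasis H i, CFC.sqrt (star T * T) (stdBasis H i)⟫_ℂ).re

/-- `T` is of trace class. -/
def IsTraceClass (T : H →L[ℂ] H) : Prop := traceNorm T < ∞

/-- The trace of a trace class operator. -/
def trace (T : H →L[ℂ] H) : ℂ := ∑' i, ⟪stdBasis H i, T (stdBasis H i)⟫_ℂ

/-- Density operators: positive trace class operators of trace one. -/
structure IsDensity (r : H →L[ℂ] H) : Prop where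
  isPositive : r.IsPositive
  isTraceClass : IsTraceClass r
  trace_eq_one : trace r = 1

theorem IsDensity.sqrt_mul_sqrt {r : H →L[ℂ] H} (hr : IsDensity r) :
    CFC.sqrt r * CFC.sqrt r = r :=
  CFC.sqrt_mul_sqrt_self r ((ContinuousLinearMap.nonneg_iff_isPositive r).2 hr.isPositive)

theorem IsDensity.isHilbertSchmidt_sqrt {r : H →L[ℂ] H} (hr : IsDensity r) :
    IsHilbertSchmidt (CFC.sqrt r) := by
  have h0 : 0 ≤ r := (ContinuousLinearMap.nonneg_iff_isPositive r).2 hr.isPositive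
  have h1 : CFC.sqrt (star r * r) = r := by
    rw [h0.isSelfAdjoint.star_eq, CFC.sqrt_mul_self r h0]
  have h2 : ∀ x : H, ‖CFC.sqrt r x‖ ^ 2 = (⟪x, r x⟫_ℂ).re := fun x => by
    have hs : star (CFC.sqrt r) = CFC.sqrt r := (CFC.sqrt_nonneg r).isSelfAdjoint.star_eq
    have h3 : r x = star (CFC.sqrt r) (CFC.sqrt r x) := by
      rw [hs]; exact congrArg (fun T : H →L[ℂ] H => T x) hr.sqrt_mul_sqrt.symm
    rw [h3, ContinuousLinearMap.star_eq_adjoint, ContinuousLinearMap.adjoint_inner_right]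
    exact norm_sq_eq_re_inner (𝕜 := ℂ) _
  have h4 := hr.isTraceClass
  rw [IsTraceClass, traceNorm, h1] at h4
  unfold IsHilbertSchmidt
  simp only [h2]
  refine (ENNReal.summable_toReal h4.ne).congr fun i => ?_
  rw [ENNReal.toReal_ofReal]
  rw [← h2]; positivity

/-- The strict positivity `r > 0`. -/
def IsStrictlyPos (r : H →L[ℂ] H) : Prop := ∀ x : H, x ≠ 0 → 0 < (⟪x, r x⟫_ℂ).re

/-- Fréchet differentiability at `θ`, relative to `Θ`, of a map into the trace class equipped with
the trace norm: `D` is a linear map into the trace class which is bounded for the trace norm, and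
`‖ρ(θ') - ρ(θ) - D[θ' - θ]‖₁ = o(‖θ' - θ‖)` as `θ' → θ` in `Θ`. -/
structure HasTraceFDerivWithinAt {Ξ : Type*} [NormedAddCommGroup Ξ] [InnerProductSpace ℝ Ξ]
    (ρ : Ξ → H →L[ℂ] H) (D : Ξ →ₗ[ℝ] (H →L[ℂ] H)) (Θ : Set Ξ) (θ : Ξ) : Prop where
  bounded : ∃ C : ℝ, ∀ φ, traceNorm (D φ) ≤ ENNReal.ofReal (C * ‖φ‖)
  isLittleO : ∀ ε : ℝ, 0 < ε → ∀ᶠ θ' in 𝓝[Θ] θ,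
    traceNorm (ρ θ' - ρ θ - D (θ' - θ)) ≤ ENNReal.ofReal (ε * ‖θ' - θ‖)

/-! ### Logarithmic derivatives of a density operator -/

/-- `A` represents a symmetric logarithmic derivative `L` of the state `r` for the derivative `d`,
that is a solution of `(r L + L r) / 2 = d`, where `L` is a possibly unbounded symmetric operator
of finite second moment in the state `r` (an element of the space `L²(r)`). As usual such an `L`
is given by the Hilbert–Schmidt operator `A = L √r`: it is the operator with domain the range of
`√r` that maps `√r x` to `A x`. It is symmetric if and only if `√r A = √r L √r` is self-adjoint,
and then `L r = A √r` and `r L = √r A*`. -/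
structure IsSLD (r d A : H →L[ℂ] H) : Prop where
  isHilbertSchmidt : IsHilbertSchmidt A
  isSelfAdjoint : IsSelfAdjoint (CFC.sqrt r * A)
  eqn : (2⁻¹ : ℂ) • (CFC.sqrt r * star A + A * CFC.sqrt r) = d

/-- `Y` represents the right logarithmic derivative `L` of the state `r` for the derivative `d`,
that is the solution of `r L = d`, in the Hilbert space obtained by completing the bounded
operators for the inner product `Tr[X* r Z]`. As usual its elements `L` are given by the
Hilbert–Schmidt operator `Y = √r L`. -/
structure IsRLD (r d Y : H →L[ℂ] H) : Prop where
  isHilbertSchmidt : IsHilbertSchmidt Y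
  eqn : CFC.sqrt r * Y = d

/-- For a bounded operator `L` the notion is the literal one. -/
theorem IsSLD.of_bounded {r d L : H →L[ℂ] H} (hr : IsDensity r) (hL : IsSelfAdjoint L)
    (h : (2⁻¹ : ℂ) • (r * L + L * r) = d) : IsSLD r d (L * CFC.sqrt r) := by
  have hs : star (CFC.sqrt r) = CFC.sqrt r := (CFC.sqrt_nonneg r).isSelfAdjoint.star_eq
  have hq : CFC.sqrt r * CFC.sqrt r = r := hr.sqrt_mul_sqrt
  refine ⟨?_, ?_, ?_⟩
  · refine Summable.of_nonneg_of_le (fun _ => by positivity) (fun i => ?_)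
      (hr.isHilbertSchmidt_sqrt.mul_left (‖L‖ ^ 2))
    rw [← mul_pow]
    exact pow_le_pow_left₀ (norm_nonneg _) (L.le_opNorm _) 2
  · simp [isSelfAdjoint_iff, hs, hL.star_eq, mul_assoc]
  · rw [← h, star_mul, hs, hL.star_eq, ← mul_assoc, hq, mul_assoc, hq]

/-- For a bounded operator `L` the notion is the literal one (`√r L` is then Hilbert–Schmidt because
`√r` is). -/
theorem IsRLD.of_bounded {r d L : H →L[ℂ] H} (hr : IsDensity r) (h : r * L = d)
    (hL : IsHilbertSchmidt (CFC.sqrt r * L)) : IsRLD r d (CFC.sqrt r * L) :=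
  ⟨hL, by rw [← mul_assoc, hr.sqrt_mul_sqrt, h]⟩

end Operators

/-! ### The complexification of a real Hilbert space -/

/-- The complexification `Ξ + i Ξ` of a real Hilbert space; `(φ₁, φ₂)` stands for `φ₁ + i φ₂`. -/
def Cx (Ξ : Type*) : Type _ := WithLp 2 (Ξ × Ξ)

namespace Cx

variable {Ξ : Type*} [NormedAddCommGroup Ξ] [InnerProductSpace ℝ Ξ]

instance : NormedAddCommGroup (Cx Ξ) := inferInstanceAs (NormedAddCommGroup (WithLp 2 (Ξ × Ξ)))

/-- The vector `φ₁ + i φ₂`. -/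
def mk (φ₁ φ₂ : Ξ) : Cx Ξ := WithLp.toLp 2 (φ₁, φ₂)

/-- The real part. -/
def re (φ : Cx Ξ) : Ξ := WithLp.fst (p := 2) (α := Ξ) (β := Ξ) φ

/-- The imaginary part. -/
def im (φ : Cx Ξ) : Ξ := WithLp.snd (p := 2) (α := Ξ) (β := Ξ) φ

@[ext] theorem ext {φ χ : Cx Ξ} (h₁ : φ.re = χ.re) (h₂ : φ.im = χ.im) : φ = χ :=
  WithLp.ofLp_injective 2 (Prod.ext h₁ h₂)

@[simp] theorem re_mk (a b : Ξ) : (mk a b).re = a := rfl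
@[simp] theorem im_mk (a b : Ξ) : (mk a b).im = b := rfl
@[simp] theorem re_add (φ χ : Cx Ξ) : (φ + χ).re = φ.re + χ.re := rfl
@[simp] theorem im_add (φ χ : Cx Ξ) : (φ + χ).im = φ.im + χ.im := rfl
@[simp] theorem re_zero : (0 : Cx Ξ).re = 0 := rfl
@[simp] theorem im_zero : (0 : Cx Ξ).im = 0 := rfl

theorem norm_sq (φ : Cx Ξ) : ‖φ‖ ^ 2 = ‖φ.re‖ ^ 2 + ‖φ.im‖ ^ 2 :=
  WithLp.prod_norm_sq_eq_of_L2 (α := Ξ) (β := Ξ) φ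

instance : SMul ℂ (Cx Ξ) where
  smul z φ := mk (z.re • φ.re - z.im • φ.im) (z.re • φ.im + z.im • φ.re)

@[simp] theorem re_smul (z : ℂ) (φ : Cx Ξ) : (z • φ).re = z.re • φ.re - z.im • φ.im := rfl
@[simp] theorem im_smul (z : ℂ) (φ : Cx Ξ) : (z • φ).im = z.re • φ.im + z.im • φ.re := rfl

instance : Module ℂ (Cx Ξ) where
  one_smul φ := by ext <;> simp
  mul_smul z w φ := by ext <;> simp <;> module
  smul_zero z := by ext <;> simp
  smul_add z φ χ := by ext <;> simp <;> module
  add_smul z w φ := by ext <;> simp <;> module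
  zero_smul φ := by ext <;> simp

instance : Inner ℂ (Cx Ξ) where
  inner φ χ := ⟨⟪φ.re, χ.re⟫_ℝ + ⟪φ.im, χ.im⟫_ℝ, ⟪φ.re, χ.im⟫_ℝ - ⟪φ.im, χ.re⟫_ℝ⟩

theorem inner_def (φ χ : Cx Ξ) :
    ⟪φ, χ⟫_ℂ = ⟨⟪φ.re, χ.re⟫_ℝ + ⟪φ.im, χ.im⟫_ℝ, ⟪φ.re, χ.im⟫_ℝ - ⟪φ.im, χ.re⟫_ℝ⟩ := rfl

theorem norm_smul_eq (z : ℂ) (φ : Cx Ξ) : ‖z • φ‖ = ‖z‖ * ‖φ‖ := by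
  rw [← sq_eq_sq₀ (norm_nonneg _) (by positivity), mul_pow, norm_sq, norm_sq, Complex.sq_norm,
    Complex.normSq_apply, re_smul, im_smul, @norm_sub_sq_real, @norm_add_sq_real]
  simp only [norm_smul, mul_pow, inner_smul_left, inner_smul_right, Real.norm_eq_abs, sq_abs,
    real_inner_comm φ.re φ.im, conj_trivial]
  ring

instance : InnerProductSpace ℂ (Cx Ξ) where
  norm_smul_le z φ := (norm_smul_eq z φ).le
  norm_sq_eq_re_inner φ := by
    rw [norm_sq, inner_def]
    simp
  conj_inner_symm φ χ := by
    apply Complex.ext <;> simp [inner_def, real_inner_comm]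
  add_left φ χ ψ := by
    apply Complex.ext <;> simp [inner_def, inner_add_left] <;> ring
  smul_left φ χ z := by
    apply Complex.ext <;>
      simp [inner_def, inner_add_left, inner_sub_left, inner_smul_left] <;> ring

/-- The complex linear extension of a bounded operator on `Ξ` to the complexification. -/
def map (J : Ξ →L[ℝ] Ξ) : Cx Ξ →L[ℂ] Cx Ξ :=
  LinearMap.mkContinuous
    { toFun := fun φ => mk (J φ.re) (J φ.im)
      map_add' := fun φ χ => by ext <;> simp
      map_smul' := fun z φ => by ext <;> simp }
    ‖J‖ (fun φ => by
      refine le_of_sq_le_sq ?_ (by positivity)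
      have h₁ := pow_le_pow_left₀ (norm_nonneg _) (J.le_opNorm φ.re) 2
      have h₂ := pow_le_pow_left₀ (norm_nonneg _) (J.le_opNorm φ.im) 2
      rw [mul_pow] at h₁ h₂ ⊢
      rw [norm_sq φ, mul_add]
      exact (norm_sq _).trans_le (add_le_add h₁ h₂))

@[simp] theorem re_map (J : Ξ →L[ℝ] Ξ) (φ : Cx Ξ) : (map J φ).re = J φ.re := rfl
@[simp] theorem im_map (J : Ξ →L[ℝ] Ξ) (φ : Cx Ξ) : (map J φ).im = J φ.im := rfl

end Cx

/-! ### Classical Fisher information -/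

section Classical

variable {Ξ : Type*} [NormedAddCommGroup Ξ] [InnerProductSpace ℝ Ξ]
  {Ω : Type*} [MeasurableSpace Ω]

/-- `l` is the logarithmic derivative at `θ` in the direction `φ` of the family `P` of measures:
the Radon–Nikodým derivative with respect to `P θ` of the set function `B ↦ D_θ P_θ(B)[φ]`. -/
structure IsLogDeriv (P : Ξ → Measure Ω) (Θ : Set Ξ) (θ φ : Ξ) (l : Ω → ℝ) : Prop where
  integrable : Integrable l (P θ)
  eqn : ∀ B, MeasurableSet B →
    fderivWithin ℝ (fun ϑ => (P ϑ).real B) Θ θ φ = ∫ x in B, l x ∂(P θ)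

/-- `J` is the Fisher information operator at `θ` of the family `P`: all the `P_θ(B)` are Fréchet
differentiable, the logarithmic derivatives `l(φ)` exist and are square integrable in all
directions, and `(φ, J χ) = E_θ[l(φ) l(χ)]`. When `l(φ) = (κ, φ)` for a logarithmic gradient
`κ` with square integrable norm, this says `J = E_θ[κ κ*]`; see
`isFisherInfo_iff_of_logGradient`. -/
def IsFisherInfo (P : Ξ → Measure Ω) (Θ : Set Ξ) (θ : Ξ) (J : Ξ →L[ℝ] Ξ) : Prop :=
  (∀ B, MeasurableSet B → DifferentiableWithinAt ℝ (fun ϑ => (P ϑ).real B) Θ θ) ∧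
  ∃ l : Ξ → Ω → ℝ, (∀ φ, IsLogDeriv P Θ θ φ (l φ)) ∧ (∀ φ, MemLp (l φ) 2 (P θ)) ∧
    ∀ φ χ, ⟪φ, J χ⟫_ℝ = ∫ x, l φ x * l χ x ∂(P θ)

theorem IsLogDeriv.ae_eq {P : Ξ → Measure Ω} {Θ : Set Ξ} {θ φ : Ξ} {l l' : Ω → ℝ}
    (h : IsLogDeriv P Θ θ φ l) (h' : IsLogDeriv P Θ θ φ l') : l =ᵐ[P θ] l' :=
  h.integrable.ae_eq_of_forall_setIntegral_eq _ _ h'.integrable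
    fun B hB _ => (h.eqn B hB).symm.trans (h'.eqn B hB)

/-- If there is a logarithmic gradient `κ` with square integrable norm, then the Fisher information
operator is `E_θ[κ κ*]`. -/
theorem isFisherInfo_iff_of_logGradient [CompleteSpace Ξ] {P : Ξ → Measure Ω} {Θ : Set Ξ} {θ : Ξ}
    (hP : ∀ B, MeasurableSet B → DifferentiableWithinAt ℝ (fun ϑ => (P ϑ).real B) Θ θ)
    {κ : Ω → Ξ} (hκ : MemLp κ 2 (P θ)) (hl : ∀ φ, IsLogDeriv P Θ θ φ fun x => ⟪κ x, φ⟫_ℝ)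
    (J : Ξ →L[ℝ] Ξ) :
    IsFisherInfo P Θ θ J ↔ ∀ φ, J φ = ∫ x, ⟪κ x, φ⟫_ℝ • κ x ∂(P θ) := by
  have hm : ∀ φ, MemLp (fun x => ⟪κ x, φ⟫_ℝ) 2 (P θ) := fun φ => hκ.inner_const φ
  have hint : ∀ φ, Integrable (fun x => ⟪κ x, φ⟫_ℝ • κ x) (P θ) := fun φ =>
    memLp_one_iff_integrable.1 (hκ.smul (hm φ))
  have key : ∀ φ χ, ⟪φ, ∫ x, ⟪κ x, χ⟫_ℝ • κ x ∂(P θ)⟫_ℝ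
      = ∫ x, ⟪κ x, φ⟫_ℝ * ⟪κ x, χ⟫_ℝ ∂(P θ) := fun φ χ => by
    rw [← integral_inner (hint χ)]
    refine integral_congr_ae (Eventually.of_forall fun x => ?_)
    simp only [inner_smul_right, real_inner_comm φ, mul_comm]
  constructor
  · rintro ⟨-, l, h₁, -, h₃⟩ χ
    refine ext_inner_left ℝ fun φ => ?_
    rw [h₃, key]
    refine integral_congr_ae ?_
    filter_upwards [(h₁ φ).ae_eq (hl φ), (h₁ χ).ae_eq (hl χ)] with x e₁ e₂
    rw [e₁, e₂]
  · intro h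
    exact ⟨hP, fun φ x => ⟪κ x, φ⟫_ℝ, hl, hm, fun φ χ => by rw [h, key]⟩

end Classical

/-! ### Quantum statistical models and measurements -/

section Quantum

/-- A positive operator-valued measure on the measurable space `Ω` (only the values at measurable
sets matter). -/
structure POVM (Ω : Type*) [MeasurableSpace Ω] (H : Type*) [NormedAddCommGroup H]
    [InnerProductSpace ℂ H] where
  toFun : Set Ω → H →L[ℂ] H
  isPositive : ∀ B, MeasurableSet B → (toFun B).IsPositive
  map_univ : toFun Set.univ = 1
  hasSum_iUnion : ∀ B : ℕ → Set Ω, (∀ n, MeasurableSet (B n)) →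
    Pairwise (Function.onFun Disjoint B) →
    ∀ x y : H, HasSum (fun n => ⟪x, toFun (B n) y⟫_ℂ) ⟪x, toFun (⋃ n, B n) y⟫_ℂ

variable (H : Type*) [NormedAddCommGroup H] [InnerProductSpace ℂ H] [CompleteSpace H]
  (Ξ : Type*) [NormedAddCommGroup Ξ] [InnerProductSpace ℝ Ξ]

/-- A quantum statistical model: a family of strictly positive density operators `ρ(θ)`, `θ ∈ Θ`,
that is Fréchet differentiable for the trace norm, with derivative `D θ` at `θ ∈ Θ`. The
parameter set `Θ ⊆ Ξ` need not be open; it is only required that derivatives relative to `Θ` are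
unique. -/
structure Model where
  Θ : Set Ξ
  uniqueDiff : UniqueDiffOn ℝ Θ
  ρ : Ξ → H →L[ℂ] H
  isDensity : ∀ θ ∈ Θ, IsDensity (ρ θ)
  isStrictlyPos : ∀ θ ∈ Θ, IsStrictlyPos (ρ θ)
  D : Ξ → Ξ →ₗ[ℝ] (H →L[ℂ] H)
  hasDeriv : ∀ θ ∈ Θ, HasTraceFDerivWithinAt ρ (D θ) Θ θ

variable {H Ξ}

namespace Model

/-- `P` is the family of outcome distributions `P_θ(B) = Tr[ρ(θ) M(B)]`, `θ ∈ Θ`, of the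
measurement `M`. -/
def IsOutcomeLaw (S : Model H Ξ) {Ω : Type*} [MeasurableSpace Ω] (M : POVM Ω H)
    (P : Ξ → Measure Ω) : Prop :=
  ∀ θ ∈ S.Θ, IsProbabilityMeasure (P θ) ∧
    ∀ B, MeasurableSet B → ((P θ).real B : ℂ) = trace (S.ρ θ * M.toFun B)

/-- `J` is the Fisher information operator `J^M_θ` of the measurement `M`. -/
def IsMeasFisher (S : Model H Ξ) (θ : Ξ) {Ω : Type*} [MeasurableSpace Ω] (M : POVM Ω H)
    (J : Ξ →L[ℝ] Ξ) : Prop :=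
  ∃ P : Ξ → Measure Ω, S.IsOutcomeLaw M P ∧ IsFisherInfo P S.Θ θ J

/-- The model has symmetric logarithmic derivatives at `θ` in all directions. -/
def HasSLD (S : Model H Ξ) (θ : Ξ) : Prop := ∀ φ, ∃ A, IsSLD (S.ρ θ) (S.D θ φ) A

/-- The model has right logarithmic derivatives at `θ` in all directions. -/
def HasRLD (S : Model H Ξ) (θ : Ξ) : Prop := ∀ φ, ∃ Y, IsRLD (S.ρ θ) (S.D θ φ) Y

/-- `J` is the SLD Fisher information operator `J^S_θ`: `(φ, J χ) = Tr[K(L(φ))* L(χ)]` with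
`K(X) = (ρ X + X ρ) / 2` and `L` the symmetric logarithmic derivative. In terms of `A = L √ρ`
the right-hand side is `((A(φ), A(χ))_HS + (A(χ), A(φ))_HS) / 2 = Re (A(φ), A(χ))_HS`. -/
def IsSLDFisher (S : Model H Ξ) (θ : Ξ) (J : Ξ →L[ℝ] Ξ) : Prop :=
  ∃ A : Ξ → H →L[ℂ] H, (∀ φ, IsSLD (S.ρ θ) (S.D θ φ) (A φ)) ∧
    ∀ φ χ, ⟪φ, J χ⟫_ℝ = (hsInner (A φ) (A χ)).re

/-- `J` is the RLD Fisher information operator `J^R_θ` on the complexification of `Ξ`: its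
sesquilinear form is the sesquilinear extension of `h(φ, χ) = Tr[K(L(φ))* L(χ)]` with
`K(X) = ρ X` and `L` the right logarithmic derivative, that is `h(φ, χ) = (Y(φ), Y(χ))_HS` in
terms of `Y = √ρ L`. -/
def IsRLDFisher (S : Model H Ξ) (θ : Ξ) (J : Cx Ξ →L[ℂ] Cx Ξ) : Prop :=
  ∃ Y : Ξ → H →L[ℂ] H, (∀ φ, IsRLD (S.ρ θ) (S.D θ φ) (Y φ)) ∧
    ∀ φ χ : Cx Ξ, ⟪φ, J χ⟫_ℂ =
      hsInner (Y φ.re) (Y χ.re) + Complex.I * hsInner (Y φ.re) (Y χ.im)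
        - Complex.I * hsInner (Y φ.im) (Y χ.re) + hsInner (Y φ.im) (Y χ.im)

end Model

end Quantum

end QEst

end

noncomputable section

namespace QEst

/-!
The outcome law of a measurement `M` is `B ↦ (√ρ, M(B) √ρ)_HS`, and its derivative in the direction
`φ` is `B ↦ Re (A_φ, M(B) √ρ)_HS`, or `B ↦ (Y_φ*, M(B) √ρ)_HS` for the right logarithmic derivative.
By Cauchy–Schwarz for the positive form `(·, M(B) ·)_HS`, such a set function has a square
integrable density with respect to the outcome law, of second moment at most the squared
Hilbert–Schmidt norm of `A_φ` or `Y_φ`: these are the inequalities between the information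
operators. Boundedness of the operators comes from the closed graph theorem, the logarithmic
derivatives being unique because `ρ > 0`.

For attainment one would measure the spectral decomposition of `L = A √ρ⁻¹`, but this unbounded
symmetric operator need not be self-adjoint. Symmetry makes `(A + i√ρ) x ↦ (A - i√ρ) x` isometric
(the Cayley transform of `L`), and a Halmos dilation extends it to a unitary of `H ⊕ H`. The
compression to `H` of the spectral measure of that unitary is a measurement with outcome density
`(α + β l)²` in the vector `α √ρ x + β A x` relative to `√ρ x`, and its logarithmic derivative `l`
has second moment `‖A‖²`.
-/

/-! ### The Hilbert space of Hilbert–Schmidt operators -/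

section HilbertSchmidt

variable {H : Type*} [NormedAddCommGroup H] [InnerProductSpace ℂ H] [CompleteSpace H]
  {A B C : H →L[ℂ] H}

variable (H) in
/-- The Hilbert space of square summable families of vectors indexed by `stdBasis H`; a
Hilbert–Schmidt operator is identified with the family of its values on the basis. -/
abbrev HSSpace : Type _ := lp (fun _ : basisIndex H => H) 2

/-- The Hilbert–Schmidt norm, with the junk value `0` if `A` is not Hilbert–Schmidt. -/
def hsNorm (A : H →L[ℂ] H) : ℝ := √(∑' i, ‖A (stdBasis H i)‖ ^ 2)

/-- A Hilbert–Schmidt operator as an element of the Hilbert space `HSSpace H`. -/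
def IsHilbertSchmidt.vec (hA : IsHilbertSchmidt A) : HSSpace H :=
  ⟨fun i => A (stdBasis H i), memℓp_gen (by simpa [IsHilbertSchmidt] using hA)⟩

theorem inner_star_apply (A : H →L[ℂ] H) (x y : H) : ⟪star A x, y⟫_ℂ = ⟪x, A y⟫_ℂ :=
  A.adjoint_inner_left y x

theorem inner_apply_star (A : H →L[ℂ] H) (x y : H) : ⟪x, star A y⟫_ℂ = ⟪A x, y⟫_ℂ :=
  A.adjoint_inner_right x y

theorem hsNorm_nonneg (A : H →L[ℂ] H) : 0 ≤ hsNorm A := Real.sqrt_nonneg _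

theorem hsNorm_sq (A : H →L[ℂ] H) : hsNorm A ^ 2 = ∑' i, ‖A (stdBasis H i)‖ ^ 2 :=
  Real.sq_sqrt (tsum_nonneg fun _ => by positivity)

theorem IsHilbertSchmidt.inner_vec (hA : IsHilbertSchmidt A) (hB : IsHilbertSchmidt B) :
    ⟪hA.vec, hB.vec⟫_ℂ = hsInner A B := rfl

theorem IsHilbertSchmidt.hasSum_inner (hA : IsHilbertSchmidt A) (hB : IsHilbertSchmidt B) :
    HasSum (fun i => ⟪A (stdBasis H i), B (stdBasis H i)⟫_ℂ) (hsInner A B) :=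
  lp.hasSum_inner (𝕜 := ℂ) hA.vec hB.vec

theorem IsHilbertSchmidt.norm_vec (hA : IsHilbertSchmidt A) : ‖hA.vec‖ = hsNorm A := by
  have h := lp.norm_rpow_eq_tsum (p := 2) (E := fun _ : basisIndex H => H) (by simp) hA.vec
  rw [hsNorm, eq_comm, Real.sqrt_eq_iff_eq_sq (tsum_nonneg fun _ => by positivity) (norm_nonneg _)]
  simp only [ENNReal.toReal_ofNat, Real.rpow_ofNat] at h
  exact h.symm

theorem hsInner_self (hA : IsHilbertSchmidt A) : hsInner A A = ((hsNorm A ^ 2 : ℝ) : ℂ) := by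
  rw [← hA.inner_vec hA, inner_self_eq_norm_sq_to_K, hA.norm_vec, Complex.ofReal_pow]
  rfl

theorem conj_hsInner (A B : H →L[ℂ] H) : starRingEnd ℂ (hsInner A B) = hsInner B A := by
  rw [hsInner, Complex.conj_tsum]
  exact tsum_congr fun i => inner_conj_symm _ _

theorem IsHilbertSchmidt.norm_hsInner_le (hA : IsHilbertSchmidt A) (hB : IsHilbertSchmidt B) :
    ‖hsInner A B‖ ≤ hsNorm A * hsNorm B := by
  rw [← hA.inner_vec hB, ← hA.norm_vec, ← hB.norm_vec]
  exact norm_inner_le_norm _ _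

theorem IsHilbertSchmidt.add (hA : IsHilbertSchmidt A) (hB : IsHilbertSchmidt B) :
    IsHilbertSchmidt (A + B) := by
  have h := (memℓp_gen_iff (p := 2) (by simp)).1 (hA.vec + hB.vec).2
  simp only [ENNReal.toReal_ofNat, Real.rpow_ofNat] at h
  exact h

theorem IsHilbertSchmidt.mul_left (X : H →L[ℂ] H) (hA : IsHilbertSchmidt A) :
    IsHilbertSchmidt (X * A) := by
  refine Summable.of_nonneg_of_le (fun _ => by positivity) (fun i => ?_)
    (Summable.mul_left (‖X‖ ^ 2) hA)
  rw [← mul_pow]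
  exact pow_le_pow_left₀ (norm_nonneg _) (X.le_opNorm _) 2

theorem hsNorm_mul_left_le (X : H →L[ℂ] H) (hA : IsHilbertSchmidt A) :
    hsNorm (X * A) ≤ ‖X‖ * hsNorm A := by
  refine le_of_sq_le_sq ?_ (mul_nonneg (norm_nonneg _) (hsNorm_nonneg _))
  rw [mul_pow, hsNorm_sq, hsNorm_sq, ← tsum_mul_left]
  refine (hA.mul_left X).tsum_le_tsum (fun i => ?_) (Summable.mul_left (‖X‖ ^ 2) hA)
  rw [← mul_pow]
  exact pow_le_pow_left₀ (norm_nonneg _) (X.le_opNorm _) 2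

theorem IsHilbertSchmidt.const_smul (c : ℂ) (hA : IsHilbertSchmidt A) :
    IsHilbertSchmidt (c • A) := by
  simpa using hA.mul_left (c • (1 : H →L[ℂ] H))

theorem hsInner_add_right (hA : IsHilbertSchmidt A) (hB : IsHilbertSchmidt B)
    (hC : IsHilbertSchmidt C) : hsInner A (B + C) = hsInner A B + hsInner A C :=
  inner_add_right hA.vec hB.vec hC.vec

theorem hsInner_add_left (hA : IsHilbertSchmidt A) (hB : IsHilbertSchmidt B)
    (hC : IsHilbertSchmidt C) : hsInner (A + B) C = hsInner A C + hsInner B C :=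
  inner_add_left hA.vec hB.vec hC.vec

theorem hasSum_norm_inner_stdBasis_sq (x : H) :
    HasSum (fun i => ‖⟪stdBasis H i, x⟫_ℂ‖ ^ 2) (‖x‖ ^ 2) := by
  rw [← inner_self_eq_norm_sq (𝕜 := ℂ) x]
  refine (Complex.hasSum_re ((stdBasis H).hasSum_inner_mul_inner x x)).congr_fun fun i => ?_
  rw [← inner_conj_symm x, mul_comm, Complex.mul_conj, Complex.ofReal_re, Complex.normSq_eq_norm_sq]

theorem IsHilbertSchmidt.summable_norm_inner_sq (hA : IsHilbertSchmidt A) :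
    Summable fun p : basisIndex H × basisIndex H =>
      ‖⟪stdBasis H p.2, A (stdBasis H p.1)⟫_ℂ‖ ^ 2 := by
  rw [summable_prod_of_nonneg (fun _ => sq_nonneg _)]
  refine ⟨fun i => (hasSum_norm_inner_stdBasis_sq (A (stdBasis H i))).summable, ?_⟩
  exact Summable.congr hA fun i =>
    (hasSum_norm_inner_stdBasis_sq (A (stdBasis H i))).tsum_eq.symm

theorem IsHilbertSchmidt.star (hA : IsHilbertSchmidt A) : IsHilbertSchmidt (star A) := by
  have h := hA.summable_norm_inner_sq.prod_symm
  rw [summable_prod_of_nonneg (fun _ => sq_nonneg _)] at h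
  refine h.2.congr fun j => ?_
  rw [← (hasSum_norm_inner_stdBasis_sq _).tsum_eq]
  refine tsum_congr fun i => ?_
  rw [inner_apply_star, norm_inner_symm]
  rfl

theorem hsInner_star (hA : IsHilbertSchmidt A) (hB : IsHilbertSchmidt B) :
    hsInner (star A) (star B) = hsInner B A := by
  have hs : Summable (Function.uncurry fun i j : basisIndex H =>
      ⟪B (stdBasis H i), stdBasis H j⟫_ℂ * ⟪stdBasis H j, A (stdBasis H i)⟫_ℂ) := by
    refine Summable.of_norm_bounded
      (hA.summable_norm_inner_sq.add hB.summable_norm_inner_sq) fun p => ?_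
    simp only [Function.uncurry, norm_mul, norm_inner_symm (B _)]
    nlinarith [sq_nonneg (‖⟪stdBasis H p.2, A (stdBasis H p.1)⟫_ℂ‖ -
      ‖⟪stdBasis H p.2, B (stdBasis H p.1)⟫_ℂ‖), sq_nonneg ‖⟪stdBasis H p.2, A (stdBasis H p.1)⟫_ℂ‖,
      sq_nonneg ‖⟪stdBasis H p.2, B (stdBasis H p.1)⟫_ℂ‖]
  have exchange := hs.tsum_comm
  simp only [(stdBasis H).tsum_inner_mul_inner] at exchange
  rw [hsInner, hsInner, ← exchange]
  refine tsum_congr fun j => ?_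
  rw [← (stdBasis H).tsum_inner_mul_inner]
  refine tsum_congr fun i => ?_
  rw [inner_star_apply, inner_apply_star, mul_comm]

theorem hsNorm_star (hA : IsHilbertSchmidt A) : hsNorm (star A) = hsNorm A := by
  have h := hsInner_star hA hA
  rw [hsInner_self hA, hsInner_self hA.star, Complex.ofReal_inj] at h
  exact (sq_eq_sq₀ (hsNorm_nonneg _) (hsNorm_nonneg _)).1 h

theorem IsHilbertSchmidt.mul_right (X : H →L[ℂ] H) (hA : IsHilbertSchmidt A) :
    IsHilbertSchmidt (A * X) := by
  simpa using (hA.star.mul_left (Star.star X)).star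

theorem hsNorm_mul_right_le (X : H →L[ℂ] H) (hA : IsHilbertSchmidt A) :
    hsNorm (A * X) ≤ hsNorm A * ‖X‖ := by
  have h := hsNorm_mul_left_le (star X) hA.star
  rw [← star_mul, hsNorm_star (hA.mul_right X), hsNorm_star hA, norm_star] at h
  rwa [mul_comm]

theorem IsHilbertSchmidt.norm_le (hA : IsHilbertSchmidt A) : ‖A‖ ≤ hsNorm A := by
  rw [← norm_star A]
  refine ContinuousLinearMap.opNorm_le_bound _ (hsNorm_nonneg _) fun y => ?_
  refine le_of_sq_le_sq ?_ (mul_nonneg (hsNorm_nonneg _) (norm_nonneg _))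
  rw [mul_pow, hsNorm_sq, ← tsum_mul_right, ← (hasSum_norm_inner_stdBasis_sq _).tsum_eq]
  refine (hasSum_norm_inner_stdBasis_sq _).summable.tsum_le_tsum (fun i => ?_)
    (Summable.mul_right (‖y‖ ^ 2) hA)
  rw [inner_apply_star, ← mul_pow]
  exact pow_le_pow_left₀ (norm_nonneg _) (norm_inner_le_norm _ _) 2

theorem trace_mul_eq_hsInner (A B : H →L[ℂ] H) : trace (A * B) = hsInner (star A) B :=
  tsum_congr fun _ => (inner_star_apply A _ _).symm

theorem trace_mul_comm (hA : IsHilbertSchmidt A) (hB : IsHilbertSchmidt B) :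
    trace (A * B) = trace (B * A) := by
  rw [trace_mul_eq_hsInner, trace_mul_eq_hsInner, ← hsInner_star hA hB.star, star_star]

end HilbertSchmidt

/-! ### Partial isometries and the trace norm -/

section PartialIsometry

variable {𝕜 E F G : Type*} [RCLike 𝕜] [NormedAddCommGroup E] [InnerProductSpace 𝕜 E]
  [NormedAddCommGroup F] [InnerProductSpace 𝕜 F]
  [NormedAddCommGroup G] [InnerProductSpace 𝕜 G] [CompleteSpace G]

theorem exists_linearIsometry_closure_range {S : E →L[𝕜] F} {T : E →L[𝕜] G}
    (h : ∀ x, ‖T x‖ = ‖S x‖) :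
    ∃ V : S.range.topologicalClosure →ₗᵢ[𝕜] G,
      ∀ x (hx : S x ∈ S.range.topologicalClosure), V ⟨S x, hx⟩ = T x := by
  have hmem : ∀ x, S x ∈ S.range.topologicalClosure := fun x =>
    Submodule.le_topologicalClosure _ ⟨x, rfl⟩
  let e : E →ₗ[𝕜] S.range.topologicalClosure := (S : E →ₗ[𝕜] F).codRestrict _ hmem
  have dense_range : DenseRange e := fun y => by
    rw [closure_subtype, ← Set.range_comp]
    exact y.2
  let V : S.range.topologicalClosure →L[𝕜] G := (T : E →ₗ[𝕜] G).extendOfNorm e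
  have hV : ∀ x, V (e x) = T x :=
    LinearMap.extendOfNorm_eq dense_range ⟨1, fun x => by rw [one_mul]; exact (h x).le⟩
  have norm_V : ∀ y, ‖V y‖ = ‖y‖ := fun y =>
    dense_range.induction_on (p := fun y => ‖V y‖ = ‖y‖) y
      (isClosed_eq V.continuous.norm continuous_norm) fun x => by rw [hV]; exact h x
  exact ⟨⟨V, norm_V⟩, fun x _ => hV x⟩

theorem adjoint_comp_self_of_isometry_comp_projection [CompleteSpace F] (K : Submodule 𝕜 F)
    [CompleteSpace K] (V : K →ₗᵢ[𝕜] G) :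
    (V.toContinuousLinearMap ∘L K.orthogonalProjectionOnto).adjoint ∘L
      (V.toContinuousLinearMap ∘L K.orthogonalProjectionOnto) = K.starProjection := by
  refine ContinuousLinearMap.ext fun x => ext_inner_left 𝕜 fun y => ?_
  rw [ContinuousLinearMap.comp_apply, ContinuousLinearMap.adjoint_inner_right]
  refine (V.inner_map_map _ _).trans ?_
  exact Submodule.inner_orthogonalProjectionOnto_eq_of_mem_right _ _

end PartialIsometry

section TraceNorm

variable {H : Type*} [NormedAddCommGroup H] [InnerProductSpace ℂ H] [CompleteSpace H]
  {S T : H →L[ℂ] H}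

theorem exists_partialIsometry (h : ∀ x, ‖T x‖ = ‖S x‖) :
    ∃ C : H →L[ℂ] H, C * S = T ∧ star C * C * S = S ∧ C * star C * C = C ∧ ‖C‖ ≤ 1 := by
  have hmem : ∀ x, S x ∈ S.range.topologicalClosure := fun x =>
    Submodule.le_topologicalClosure _ ⟨x, rfl⟩
  set K := S.range.topologicalClosure
  obtain ⟨V, hV⟩ := exists_linearIsometry_closure_range h
  let C : H →L[ℂ] H := V.toContinuousLinearMap ∘L K.orthogonalProjectionOnto
  have star_C_mul_C : star C * C = K.starProjection :=
    adjoint_comp_self_of_isometry_comp_projection K V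
  have hproj : ∀ x, K.orthogonalProjectionOnto (S x) = ⟨S x, hmem x⟩ := fun x =>
    Submodule.orthogonalProjectionOnto_mem_subspace_eq_self (⟨S x, hmem x⟩ : K)
  refine ⟨C, ContinuousLinearMap.ext fun x => ?_, ?_, ?_, ?_⟩
  · exact (congrArg V (hproj x)).trans (hV x (hmem x))
  · rw [star_C_mul_C]
    exact ContinuousLinearMap.ext fun x => Submodule.starProjection_eq_self_iff.2 (hmem x)
  · rw [mul_assoc, star_C_mul_C]
    exact ContinuousLinearMap.ext fun x => congrArg V
      (Submodule.orthogonalProjectionOnto_mem_subspace_eq_self (K.orthogonalProjectionOnto x))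
  · refine ContinuousLinearMap.opNorm_le_bound _ zero_le_one fun x => ?_
    rw [one_mul]
    exact (V.norm_map _).trans_le (Submodule.norm_orthogonalProjectionOnto_apply_le K x)

theorem star_sqrt (r : H →L[ℂ] H) : star (CFC.sqrt r) = CFC.sqrt r :=
  (CFC.sqrt_nonneg r).isSelfAdjoint.star_eq

theorem IsDensity.nonneg {r : H →L[ℂ] H} (hr : IsDensity r) : 0 ≤ r :=
  (ContinuousLinearMap.nonneg_iff_isPositive r).2 hr.isPositive

theorem norm_sqrt_apply_sq {r : H →L[ℂ] H} (hr : 0 ≤ r) (x : H) :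
    ‖CFC.sqrt r x‖ ^ 2 = (⟪x, r x⟫_ℂ).re := by
  conv_rhs => rw [← CFC.sqrt_mul_sqrt_self r hr, mul_apply_eq_comp, ← inner_star_apply, star_sqrt]
  exact norm_sq_eq_re_inner (𝕜 := ℂ) _

theorem norm_abs_apply (T : H →L[ℂ] H) (x : H) : ‖CFC.abs T x‖ = ‖T x‖ := by
  rw [← sq_eq_sq₀ (norm_nonneg _) (norm_nonneg _), CFC.abs,
    norm_sqrt_apply_sq (star_mul_self_nonneg T), mul_apply_eq_comp, inner_apply_star]
  exact (norm_sq_eq_re_inner (𝕜 := ℂ) _).symm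

theorem traceNorm_eq_tsum_norm_sqrt_abs (T : H →L[ℂ] H) :
    traceNorm T = ∑' i, ENNReal.ofReal (‖CFC.sqrt (CFC.abs T) (stdBasis H i)‖ ^ 2) := by
  simp only [norm_sqrt_apply_sq (CFC.abs_nonneg T)]
  rfl

theorem IsTraceClass.isHilbertSchmidt_sqrt_abs (hT : IsTraceClass T) :
    IsHilbertSchmidt (CFC.sqrt (CFC.abs T)) := by
  rw [IsTraceClass, traceNorm_eq_tsum_norm_sqrt_abs] at hT
  exact (ENNReal.summable_toReal hT.ne).congr fun i => ENNReal.toReal_ofReal (sq_nonneg _)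

theorem hsNorm_sqrt_abs_sq (T : H →L[ℂ] H) :
    hsNorm (CFC.sqrt (CFC.abs T)) ^ 2 = (traceNorm T).toReal := by
  rw [hsNorm_sq, traceNorm_eq_tsum_norm_sqrt_abs,
    ENNReal.tsum_toReal_eq fun _ => ENNReal.ofReal_ne_top]
  exact tsum_congr fun i => (ENNReal.toReal_ofReal (sq_nonneg _)).symm

theorem IsTraceClass.exists_eq_mul (hT : IsTraceClass T) :
    ∃ A B : H →L[ℂ] H, IsHilbertSchmidt A ∧ IsHilbertSchmidt B ∧ A * B = T ∧
      hsNorm A * hsNorm B ≤ (traceNorm T).toReal := by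
  set q := CFC.sqrt (CFC.abs T)
  have hq : IsHilbertSchmidt q := hT.isHilbertSchmidt_sqrt_abs
  obtain ⟨W, hW, -, -, norm_W⟩ := exists_partialIsometry fun x => (norm_abs_apply T x).symm
  refine ⟨W * q, q, hq.mul_left W, hq, ?_, ?_⟩
  · rw [mul_assoc, CFC.sqrt_mul_sqrt_self _ (CFC.abs_nonneg T), hW]
  · rw [← hsNorm_sqrt_abs_sq, sq]
    exact mul_le_mul_of_nonneg_right ((hsNorm_mul_left_le W hq).trans
      (mul_le_of_le_one_left (hsNorm_nonneg _) norm_W)) (hsNorm_nonneg _)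

theorem IsTraceClass.norm_le (hT : IsTraceClass T) : ‖T‖ ≤ (traceNorm T).toReal := by
  obtain ⟨A, B, hA, hB, rfl, h⟩ := hT.exists_eq_mul
  exact (norm_mul_le _ _).trans
    ((mul_le_mul hA.norm_le hB.norm_le (norm_nonneg _) (hsNorm_nonneg _)).trans h)

theorem IsTraceClass.norm_trace_mul_le (hT : IsTraceClass T) (X : H →L[ℂ] H) :
    ‖trace (T * X)‖ ≤ (traceNorm T).toReal * ‖X‖ := by
  obtain ⟨A, B, hA, hB, rfl, h⟩ := hT.exists_eq_mul
  rw [mul_assoc, trace_mul_eq_hsInner]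
  calc ‖hsInner (star A) (B * X)‖ ≤ hsNorm (star A) * hsNorm (B * X) :=
        hA.star.norm_hsInner_le (hB.mul_right X)
    _ ≤ hsNorm A * (hsNorm B * ‖X‖) := by
        rw [hsNorm_star hA]
        exact mul_le_mul_of_nonneg_left (hsNorm_mul_right_le X hB) (hsNorm_nonneg _)
    _ ≤ _ := by
        rw [← mul_assoc]
        exact mul_le_mul_of_nonneg_right h (norm_nonneg _)

/-- The series defining `trace T` converges, so that its value is not a junk value. -/
def DiagSummable (T : H →L[ℂ] H) : Prop :=
  Summable fun i => ⟪stdBasis H i, T (stdBasis H i)⟫_ℂ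

theorem IsHilbertSchmidt.diagSummable_mul {A B : H →L[ℂ] H} (hA : IsHilbertSchmidt A)
    (hB : IsHilbertSchmidt B) : DiagSummable (A * B) :=
  (hA.star.hasSum_inner hB).summable.congr fun _ => inner_star_apply A _ _

theorem IsTraceClass.diagSummable_mul (hT : IsTraceClass T) (X : H →L[ℂ] H) :
    DiagSummable (T * X) := by
  obtain ⟨A, B, hA, hB, rfl, -⟩ := hT.exists_eq_mul
  rw [mul_assoc]
  exact hA.diagSummable_mul (hB.mul_right X)

theorem trace_add (hS : DiagSummable S) (hT : DiagSummable T) :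
    trace (S + T) = trace S + trace T := by
  rw [trace, trace, trace, ← Summable.tsum_add hS hT]
  exact tsum_congr fun i => by rw [add_apply, inner_add_right]

theorem DiagSummable.sub (hS : DiagSummable S) (hT : DiagSummable T) : DiagSummable (S - T) :=
  (Summable.sub hS hT).congr fun i => by rw [sub_apply, inner_sub_right]

theorem trace_sub (hS : DiagSummable S) (hT : DiagSummable T) :
    trace (S - T) = trace S - trace T := by
  simp only [trace, sub_apply, inner_sub_right]
  exact Summable.tsum_sub hS hT

theorem DiagSummable.smul (c : ℂ) (hT : DiagSummable T) : DiagSummable (c • T) :=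
  (Summable.mul_left c hT).congr fun i => by rw [smul_apply, inner_smul_right]

theorem trace_smul (c : ℂ) (T : H →L[ℂ] H) : trace (c • T) = c * trace T := by
  rw [trace, trace, ← tsum_mul_left]
  exact tsum_congr fun i => by rw [smul_apply, inner_smul_right]

end TraceNorm

/-! ### Outcome measures of a POVM -/

section OutcomeMeasures

variable {H : Type*} [NormedAddCommGroup H] [InnerProductSpace ℂ H]

theorem eq_of_forall_inner_self_eq {S T : H →L[ℂ] H} (h : ∀ x, ⟪x, S x⟫_ℂ = ⟪x, T x⟫_ℂ) :
    S = T :=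
  ContinuousLinearMap.coe_injective <| (ext_inner_map (S : H →ₗ[ℂ] H) T).1 fun x => by
    have := congrArg (starRingEnd ℂ) (h x)
    rwa [inner_conj_symm, inner_conj_symm] at this

theorem re_inner_self_nonneg {T : H →L[ℂ] H} (hT : T.IsPositive) (x : H) :
    0 ≤ (⟪x, T x⟫_ℂ).re :=
  hT.re_inner_nonneg_right x

theorem ofReal_re_inner_self {T : H →L[ℂ] H} (hT : T.IsPositive) (x : H) :
    (((⟪x, T x⟫_ℂ).re : ℝ) : ℂ) = ⟪x, T x⟫_ℂ :=
  (Complex.eq_re_of_ofReal_le (hT.inner_nonneg_right x)).symm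

namespace POVM

variable {Ω : Type*} [MeasurableSpace Ω] (M : POVM Ω H)

theorem map_empty : M.toFun ∅ = 0 := by
  refine eq_of_forall_inner_self_eq fun x => ?_
  have h := M.hasSum_iUnion (fun _ => ∅) (fun _ => MeasurableSet.empty)
    (fun _ _ _ => by simp [Function.onFun]) x x
  rw [Set.iUnion_empty] at h
  simpa using (summable_const_iff _).1 h.summable

/-- The outcome measure `B ↦ ⟪x, M(B) x⟫` of the vector `x`. -/
def measure (x : H) : Measure Ω :=
  Measure.ofMeasurable (fun B _ => ENNReal.ofReal (⟪x, M.toFun B x⟫_ℂ).re)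
    (by simp [M.map_empty])
    (fun B hB hd => by
      have h := Complex.hasSum_re (M.hasSum_iUnion B hB hd x x)
      rw [← h.tsum_eq, ENNReal.ofReal_tsum_of_nonneg
        (fun n => re_inner_self_nonneg (M.isPositive _ (hB n)) x) h.summable])

theorem measure_apply (x : H) {B : Set Ω} (hB : MeasurableSet B) :
    M.measure x B = ENNReal.ofReal (⟪x, M.toFun B x⟫_ℂ).re :=
  Measure.ofMeasurable_apply B hB

instance (x : H) : IsFiniteMeasure (M.measure x) :=
  ⟨by rw [M.measure_apply x MeasurableSet.univ]; exact ENNReal.ofReal_lt_top⟩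

theorem ofReal_measure_real (x : H) {B : Set Ω} (hB : MeasurableSet B) :
    ((M.measure x).real B : ℂ) = ⟪x, M.toFun B x⟫_ℂ := by
  rw [measureReal_def, M.measure_apply x hB,
    ENNReal.toReal_ofReal (re_inner_self_nonneg (M.isPositive _ hB) x),
    ofReal_re_inner_self (M.isPositive _ hB)]

theorem map_union {B C : Set Ω} (hB : MeasurableSet B) (hC : MeasurableSet C)
    (hd : Disjoint B C) : M.toFun (B ∪ C) = M.toFun B + M.toFun C := by
  refine eq_of_forall_inner_self_eq fun x => ?_
  rw [add_apply, inner_add_right, ← M.ofReal_measure_real x hB, ← M.ofReal_measure_real x hC,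
    ← M.ofReal_measure_real x (hB.union hC), measureReal_union hd hC, Complex.ofReal_add]

variable [CompleteSpace H] {A C r : H →L[ℂ] H} {B : Set Ω}

/-- The measure `B ↦ (A, M(B) A)_HS`, which for `A = √r` is the outcome distribution of the
measurement `M` in the state `r`. -/
def hsMeasure (A : H →L[ℂ] H) : Measure Ω := Measure.sum fun i => M.measure (A (stdBasis H i))

theorem hasSum_hsMeasure (hA : IsHilbertSchmidt A) (hB : MeasurableSet B) :
    HasSum (fun i => ((M.measure (A (stdBasis H i))).real B : ℂ)) (hsInner A (M.toFun B * A)) :=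
  (hA.hasSum_inner (hA.mul_left (M.toFun B))).congr_fun fun _ => M.ofReal_measure_real _ hB

theorem hsMeasure_apply (hA : IsHilbertSchmidt A) (hB : MeasurableSet B) :
    M.hsMeasure A B = ENNReal.ofReal (hsInner A (M.toFun B * A)).re := by
  have h : HasSum (fun i => (M.measure (A (stdBasis H i))).real B) _ :=
    Complex.hasSum_re (M.hasSum_hsMeasure hA hB)
  rw [hsMeasure, Measure.sum_apply _ hB, ← h.tsum_eq,
    ENNReal.ofReal_tsum_of_nonneg (fun _ => measureReal_nonneg) h.summable]
  exact tsum_congr fun i => (ofReal_measureReal).symm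

theorem isFiniteMeasure_hsMeasure (hA : IsHilbertSchmidt A) : IsFiniteMeasure (M.hsMeasure A) :=
  ⟨by rw [M.hsMeasure_apply hA MeasurableSet.univ]; exact ENNReal.ofReal_lt_top⟩

theorem ofReal_hsMeasure_real (hA : IsHilbertSchmidt A) (hB : MeasurableSet B) :
    ((M.hsMeasure A).real B : ℂ) = hsInner A (M.toFun B * A) := by
  have h : HasSum (fun i => (M.measure (A (stdBasis H i))).real B) _ :=
    Complex.hasSum_re (M.hasSum_hsMeasure hA hB)
  rw [measureReal_def, M.hsMeasure_apply hA hB,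
    ENNReal.toReal_ofReal (h.nonneg fun _ => measureReal_nonneg)]
  exact (Complex.hasSum_ofReal.2 h).unique (M.hasSum_hsMeasure hA hB)

theorem hsMeasure_real_univ (hA : IsHilbertSchmidt A) :
    (M.hsMeasure A).real Set.univ = hsNorm A ^ 2 := by
  rw [← Complex.ofReal_inj, M.ofReal_hsMeasure_real hA MeasurableSet.univ, M.map_univ, one_mul,
    hsInner_self hA]

theorem norm_hsInner_mul_sq_le (hA : IsHilbertSchmidt A) (hC : IsHilbertSchmidt C)
    (hB : MeasurableSet B) :
    ‖hsInner A (M.toFun B * C)‖ ^ 2 ≤ (M.hsMeasure A).real B * (M.hsMeasure C).real B := by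
  set q := CFC.sqrt (M.toFun B)
  have sqrt_split : ∀ S T : H →L[ℂ] H, hsInner S (M.toFun B * T) = hsInner (q * S) (q * T) :=
    fun S T => tsum_congr fun i => by
      rw [← CFC.sqrt_mul_sqrt_self (M.toFun B)
        ((ContinuousLinearMap.nonneg_iff_isPositive _).2 (M.isPositive B hB)), mul_assoc,
        mul_apply_eq_comp, ← inner_star_apply, star_sqrt]
      rfl
  have mass : ∀ {S : H →L[ℂ] H}, IsHilbertSchmidt S →
      (M.hsMeasure S).real B = hsNorm (q * S) ^ 2 := fun hS => by
    rw [← Complex.ofReal_inj, M.ofReal_hsMeasure_real hS hB, sqrt_split,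
      hsInner_self (hS.mul_left q)]
  rw [sqrt_split, mass hA, mass hC, ← mul_pow]
  exact pow_le_pow_left₀ (norm_nonneg _) ((hA.mul_left q).norm_hsInner_le (hC.mul_left q)) 2

/-- The outcome distribution of the measurement `M` in the state `r`. -/
def law (r : H →L[ℂ] H) : Measure Ω := M.hsMeasure (CFC.sqrt r)

theorem ofReal_law_real (hr : IsDensity r) (hB : MeasurableSet B) :
    ((M.law r).real B : ℂ) = trace (r * M.toFun B) := by
  set s := CFC.sqrt r with hs_def
  have hs : IsHilbertSchmidt s := hr.isHilbertSchmidt_sqrt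
  calc ((M.law r).real B : ℂ) = hsInner (star s) (M.toFun B * s) := by
        rw [hs_def, star_sqrt]; exact M.ofReal_hsMeasure_real hs hB
    _ = trace (s * M.toFun B * s) := by rw [← trace_mul_eq_hsInner, mul_assoc]
    _ = trace (r * M.toFun B) := by
        rw [trace_mul_comm (hs.mul_right _) hs, ← mul_assoc, hr.sqrt_mul_sqrt]

theorem isProbabilityMeasure_law (hr : IsDensity r) : IsProbabilityMeasure (M.law r) := by
  have := M.isFiniteMeasure_hsMeasure hr.isHilbertSchmidt_sqrt
  refine isProbabilityMeasure_iff_real.2 ?_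
  rw [← Complex.ofReal_inj, M.ofReal_law_real hr MeasurableSet.univ, M.map_univ, mul_one,
    hr.trace_eq_one, Complex.ofReal_one]

end POVM

end OutcomeMeasures

/-! ### Square integrable densities -/

section Density

variable {𝕜 Ω : Type*} [RCLike 𝕜] [MeasurableSpace Ω] {P Q : Measure Ω} {ν : Set Ω → 𝕜}

theorem norm_toLp_two_sq {f : Ω → 𝕜} (hf : MemLp f 2 P) :
    ‖hf.toLp f‖ ^ 2 = ∫ ω, ‖f ω‖ ^ 2 ∂P := by
  rw [norm_sq_eq_re_inner (𝕜 := 𝕜), L2.inner_def, ← integral_re (L2.integrable_inner _ _)]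
  refine integral_congr_ae ?_
  filter_upwards [hf.coeFn_toLp] with ω hω
  rw [hω]
  exact inner_self_eq_norm_sq (𝕜 := 𝕜) _

variable [IsFiniteMeasure P]

theorem integral_norm_sq_simpleFunc (f : SimpleFunc Ω 𝕜) :
    ∫ ω, ‖f ω‖ ^ 2 ∂P = ∑ c ∈ f.range, ‖c‖ ^ 2 * P.real (f ⁻¹' {c}) := by
  have h := SimpleFunc.map_integral f (fun c : 𝕜 => ‖c‖ ^ 2) f.integrable_of_isFiniteMeasure
    (μ := P) (by simp)
  rw [SimpleFunc.integral_eq_integral _ (SimpleFunc.integrable_of_isFiniteMeasure _)] at h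
  simpa [mul_comm] using h

theorem sum_measureReal_preimage {β : Type*} (f : SimpleFunc Ω β) :
    ∑ c ∈ f.range, P.real (f ⁻¹' {c}) = P.real Set.univ := by
  rw [sum_measureReal_preimage_singleton _ fun c _ => f.measurableSet_fiber c, f.coe_range,
    Set.preimage_range]

theorem norm_sum_simpleFunc_le [IsFiniteMeasure Q]
    (hν : ∀ B, MeasurableSet B → ‖ν B‖ ^ 2 ≤ Q.real B * P.real B) (f : SimpleFunc Ω 𝕜) :
    ‖∑ c ∈ f.range, c * ν (f ⁻¹' {c})‖ ≤ √(Q.real Set.univ) * √(∫ ω, ‖f ω‖ ^ 2 ∂P) := by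
  have hνf : ∀ c, ‖ν (f ⁻¹' {c})‖ ≤ √(Q.real (f ⁻¹' {c})) * √(P.real (f ⁻¹' {c})) := fun c => by
    rw [← Real.sqrt_mul measureReal_nonneg]
    exact Real.le_sqrt_of_sq_le (hν _ (f.measurableSet_fiber c))
  calc ‖∑ c ∈ f.range, c * ν (f ⁻¹' {c})‖
      ≤ ∑ c ∈ f.range, √(Q.real (f ⁻¹' {c})) * (‖c‖ * √(P.real (f ⁻¹' {c}))) := by
        refine norm_sum_le_of_le _ fun c _ => ?_
        rw [norm_mul, mul_left_comm]
        exact mul_le_mul_of_nonneg_left (hνf c) (norm_nonneg _)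
    _ ≤ √(∑ c ∈ f.range, √(Q.real (f ⁻¹' {c})) ^ 2) *
          √(∑ c ∈ f.range, (‖c‖ * √(P.real (f ⁻¹' {c}))) ^ 2) :=
        Real.sum_mul_le_sqrt_mul_sqrt _ _ _
    _ = √(Q.real Set.univ) * √(∫ ω, ‖f ω‖ ^ 2 ∂P) := by
        simp only [mul_pow, Real.sq_sqrt measureReal_nonneg, sum_measureReal_preimage,
          integral_norm_sq_simpleFunc]

theorem exists_clm_of_simpleFunc_bound {K : ℝ} (hK : 0 ≤ K)
    (hadd : ∀ B C, MeasurableSet B → MeasurableSet C → Disjoint B C → ν (B ∪ C) = ν B + ν C)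
    (hb : ∀ f : SimpleFunc Ω 𝕜,
      ‖∑ c ∈ f.range, c * ν (f ⁻¹' {c})‖ ≤ K * √(∫ ω, ‖f ω‖ ^ 2 ∂P)) :
    ∃ Φ : Lp 𝕜 2 P →L[𝕜] 𝕜, ‖Φ‖ ≤ K ∧ ∀ B (hB : MeasurableSet B),
      Φ (indicatorConstLp 2 hB (measure_ne_top P B) 1) = ν B := by
  let T : Set Ω → 𝕜 →L[ℝ] 𝕜 := fun B =>
    ((ContinuousLinearMap.id 𝕜 𝕜).smulRight (ν B)).restrictScalars ℝ
  have hT : ∀ B c, T B c = c * ν B := fun _ _ => rfl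
  have hTadd : FinMeasAdditive P T := fun B C hB hC _ _ hd => by
    ext c
    rw [add_apply, hT, hT, hT, hadd B C hB hC hd, mul_add]
  have hT0 : T ∅ = 0 := hTadd.map_empty_eq_zero
  have hi : ∀ f : SimpleFunc Ω 𝕜, Integrable f P := fun f => f.integrable_of_isFiniteMeasure
  have hm : ∀ f : SimpleFunc Ω 𝕜, MemLp f 2 P := fun f => f.memLp_of_isFiniteMeasure 2 P
  let Φ₀ : SimpleFunc Ω 𝕜 →ₗ[𝕜] 𝕜 :=
    { toFun := SimpleFunc.setToSimpleFunc T
      map_add' := fun f g => SimpleFunc.setToSimpleFunc_add T hTadd (hi f) (hi g)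
      map_smul' := fun c f => SimpleFunc.setToSimpleFunc_smul T hTadd
        (fun c B x => by simp [hT, mul_assoc]) c (hi f) }
  let e : SimpleFunc Ω 𝕜 →ₗ[𝕜] Lp 𝕜 2 P :=
    { toFun := fun f => (hm f).toLp f
      map_add' := fun f g => MemLp.toLp_add (hm f) (hm g)
      map_smul' := fun c f => MemLp.toLp_const_smul c (hm f) }
  have dense_range : DenseRange e := by
    refine (Lp.simpleFunc.denseRange (μ := P) (E := 𝕜) (p := 2) (by simp)).mono ?_
    rintro _ ⟨f, rfl⟩
    exact ⟨Lp.simpleFunc.toSimpleFunc f,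
      Lp.ext ((MemLp.coeFn_toLp (hm _)).trans (Lp.simpleFunc.toSimpleFunc_eq_toFun f))⟩
  have bound : ∀ f, ‖Φ₀ f‖ ≤ K * ‖e f‖ := fun f => by
    refine (hb f).trans_eq ?_
    rw [← norm_toLp_two_sq (hm f), Real.sqrt_sq (norm_nonneg _)]
    rfl
  refine ⟨Φ₀.extendOfNorm e, LinearMap.opNorm_extendOfNorm_le dense_range hK bound, fun B hB => ?_⟩
  refine (LinearMap.extendOfNorm_eq dense_range ⟨K, bound⟩
    (SimpleFunc.piecewise B hB (SimpleFunc.const Ω 1) (SimpleFunc.const Ω 0))).trans ?_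
  exact (SimpleFunc.setToSimpleFunc_indicator T hT0 hB (1 : 𝕜)).trans (one_mul _)

theorem exists_density_of_norm_sq_le [IsFiniteMeasure Q]
    (hadd : ∀ B C, MeasurableSet B → MeasurableSet C → Disjoint B C → ν (B ∪ C) = ν B + ν C)
    (hν : ∀ B, MeasurableSet B → ‖ν B‖ ^ 2 ≤ Q.real B * P.real B) :
    ∃ l : Ω → 𝕜, MemLp l 2 P ∧ (∀ B, MeasurableSet B → ∫ ω in B, l ω ∂P = ν B) ∧
      ∫ ω, ‖l ω‖ ^ 2 ∂P ≤ Q.real Set.univ := by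
  obtain ⟨Φ, norm_Φ, hΦ⟩ := exists_clm_of_simpleFunc_bound (Real.sqrt_nonneg _) hadd
    (norm_sum_simpleFunc_le hν)
  let k : Lp 𝕜 2 P := (InnerProductSpace.toDual 𝕜 (Lp 𝕜 2 P)).symm Φ
  have inner_k : ∀ g, ⟪k, g⟫_𝕜 = Φ g := fun g => InnerProductSpace.toDual_symm_apply
  have norm_k : ‖k‖ ≤ √(Q.real Set.univ) := by rwa [LinearIsometryEquiv.norm_map]
  have hk : MemLp k 2 P := Lp.memLp k
  refine ⟨fun ω => starRingEnd 𝕜 (k ω), hk.star, fun B hB => ?_, ?_⟩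
  · rw [← hΦ B hB, ← inner_k, ← inner_conj_symm, L2.inner_indicatorConstLp_one, integral_conj]
  · simp only [RCLike.norm_conj]
    rw [← norm_toLp_two_sq hk, Lp.toLp_coeFn, ← Real.sq_sqrt (measureReal_nonneg (μ := Q))]
    exact pow_le_pow_left₀ (norm_nonneg _) norm_k 2

theorem memLp_and_integral_norm_sq_le_of_setIntegral [IsFiniteMeasure Q] {l : Ω → 𝕜}
    (hl : Integrable l P)
    (h : ∀ B, MeasurableSet B → ‖∫ ω in B, l ω ∂P‖ ^ 2 ≤ Q.real B * P.real B) :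
    MemLp l 2 P ∧ ∫ ω, ‖l ω‖ ^ 2 ∂P ≤ Q.real Set.univ := by
  obtain ⟨k, hk, density, bound⟩ := exists_density_of_norm_sq_le
    (fun B C _ hC hd => setIntegral_union hd hC hl.integrableOn hl.integrableOn) h
  have hkl : k =ᵐ[P] l := (hk.integrable one_le_two).ae_eq_of_forall_setIntegral_eq _ _ hl
    fun B hB _ => density B hB
  refine ⟨hk.ae_eq hkl, (integral_congr_ae ?_).trans_le bound⟩
  filter_upwards [hkl] with ω hω
  rw [hω]

end Density

/-! ### Fisher information of a classical family -/

section ClosedGraph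

variable {𝕜 E F : Type*} [NontriviallyNormedField 𝕜] [NormedAddCommGroup E] [NormedSpace 𝕜 E]
  [CompleteSpace E] [NormedAddCommGroup F] [NormedSpace 𝕜 F] [CompleteSpace F]

theorem exists_clm_of_isClosed_graph (G : Submodule 𝕜 (E × F)) (hG : IsClosed (G : Set (E × F)))
    (total : ∀ x, ∃ y, (x, y) ∈ G) (single_valued : ∀ y, (0, y) ∈ G → y = 0) :
    ∃ T : E →L[𝕜] F, ∀ x, (x, T x) ∈ G := by
  have : CompleteSpace G := hG.completeSpace_coe
  let p : G →L[𝕜] E := ContinuousLinearMap.fst 𝕜 E F ∘L G.subtypeL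
  have ker_p : p.ker = ⊥ := LinearMap.ker_eq_bot'.2 fun z hz =>
    Subtype.ext <| Prod.ext hz <| single_valued _ <| by
      have h := z.2
      rwa [← Prod.mk.eta (p := (z : E × F)), show (z : E × F).1 = 0 from hz] at h
  have range_p : p.range = ⊤ := LinearMap.range_eq_top.2 fun x =>
    (total x).elim fun y hy => ⟨⟨(x, y), hy⟩, rfl⟩
  let e := ContinuousLinearEquiv.ofBijective p ker_p range_p
  refine ⟨ContinuousLinearMap.snd 𝕜 E F ∘L G.subtypeL ∘L e.symm.toContinuousLinearMap, fun x => ?_⟩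
  have hx : (e.symm x : E × F).1 = x := e.apply_symm_apply x
  have h := (e.symm x).2
  rwa [← Prod.mk.eta (p := (e.symm x : E × F)), hx] at h

end ClosedGraph

section ClassicalFisher

theorem exists_gram {𝕜 E F : Type*} [RCLike 𝕜] [NormedAddCommGroup E] [InnerProductSpace 𝕜 E]
    [CompleteSpace E] [NormedAddCommGroup F] [InnerProductSpace 𝕜 F] [CompleteSpace F]
    (T : E →L[𝕜] F) : ∃ J : E →L[𝕜] E, ∀ φ χ, ⟪φ, J χ⟫_𝕜 = ⟪T φ, T χ⟫_𝕜 :=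
  ⟨T.adjoint ∘L T, fun φ χ => T.adjoint_inner_right φ (T χ)⟩

theorem clm_ext_inner {𝕜 E : Type*} [RCLike 𝕜] [NormedAddCommGroup E] [InnerProductSpace 𝕜 E]
    {J K : E →L[𝕜] E} (h : ∀ φ χ, ⟪φ, J χ⟫_𝕜 = ⟪φ, K χ⟫_𝕜) : J = K :=
  ContinuousLinearMap.ext fun χ => ext_inner_left 𝕜 fun φ => h φ χ

variable {Ξ : Type*} [NormedAddCommGroup Ξ] [InnerProductSpace ℝ Ξ]
  {Ω : Type*} [MeasurableSpace Ω] {P : Ξ → Measure Ω} {Θ : Set Ξ} {θ : Ξ} {J J' : Ξ →L[ℝ] Ξ}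

theorem IsFisherInfo.unique (hJ : IsFisherInfo P Θ θ J) (hJ' : IsFisherInfo P Θ θ J') :
    J = J' := by
  obtain ⟨-, l, hl, -, inner_J⟩ := hJ
  obtain ⟨-, l', hl', -, inner_J'⟩ := hJ'
  refine clm_ext_inner fun φ χ => ?_
  rw [inner_J, inner_J']
  refine integral_congr_ae ?_
  filter_upwards [(hl φ).ae_eq (hl' φ), (hl χ).ae_eq (hl' χ)] with ω hφ hχ
  rw [hφ, hχ]

theorem IsFisherInfo.symm (hJ : IsFisherInfo P Θ θ J) (φ χ : Ξ) : ⟪φ, J χ⟫_ℝ = ⟪χ, J φ⟫_ℝ := by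
  obtain ⟨-, l, -, -, inner_J⟩ := hJ
  simp only [inner_J, mul_comm]

variable [CompleteSpace Ξ] [IsFiniteMeasure (P θ)]

theorem exists_clm_isLogDeriv
    (hl : ∀ φ, ∃ l, IsLogDeriv P Θ θ φ l ∧ MemLp l 2 (P θ)) :
    ∃ T : Ξ →L[ℝ] Lp ℝ 2 (P θ), ∀ φ, IsLogDeriv P Θ θ φ (T φ) := by
  let setIntegral (B : {B : Set Ω // MeasurableSet B}) : Lp ℝ 2 (P θ) →L[ℝ] ℝ :=
    innerSL ℝ (indicatorConstLp 2 B.2 (measure_ne_top _ _) 1)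
  have setIntegral_apply : ∀ B k, setIntegral B k = ∫ ω in B.1, k ω ∂(P θ) := fun B k =>
    L2.inner_indicatorConstLp_one B.2 (measure_ne_top _ _) k
  let constraint (B : {B : Set Ω // MeasurableSet B}) : Ξ × Lp ℝ 2 (P θ) →L[ℝ] ℝ :=
    (fderivWithin ℝ (fun ϑ => (P ϑ).real B.1) Θ θ).coprod (-setIntegral B)
  have mem_graph : ∀ {φ k}, (φ, k) ∈ ⨅ B, (constraint B).ker ↔ IsLogDeriv P Θ θ φ k := by
    intro φ k
    have : ∀ B, constraint B (φ, k) = 0 ↔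
        fderivWithin ℝ (fun ϑ => (P ϑ).real B.1) Θ θ φ = ∫ ω in B.1, k ω ∂(P θ) := fun B => by
      rw [← setIntegral_apply, ← sub_eq_zero (a := fderivWithin ℝ _ _ _ _), sub_eq_add_neg]
      rfl
    simp only [Submodule.mem_iInf, LinearMap.mem_ker, ContinuousLinearMap.coe_coe, this,
      Subtype.forall]
    exact ⟨fun h => ⟨(Lp.memLp k).integrable one_le_two, h⟩, fun h => h.eqn⟩
  obtain ⟨T, hT⟩ := exists_clm_of_isClosed_graph (⨅ B, (constraint B).ker)
    (by
      rw [Submodule.coe_iInf]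
      exact isClosed_iInter fun B => (constraint B).isClosed_ker)
    (fun φ => by
      obtain ⟨l, hφ, hl⟩ := hl φ
      refine ⟨hl.toLp l, mem_graph.2 ⟨(Lp.memLp _).integrable one_le_two, fun B hB => ?_⟩⟩
      rw [hφ.eqn B hB]
      exact integral_congr_ae (ae_restrict_of_ae hl.coeFn_toLp.symm))
    (fun k hk => Lp.ext <| (mem_graph.1 hk).ae_eq
      (mem_graph.1 (Submodule.zero_mem (⨅ B, (constraint B).ker))))
  exact ⟨T, fun φ => mem_graph.1 (hT φ)⟩

theorem existsUnique_isFisherInfo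
    (hP : ∀ B, MeasurableSet B → DifferentiableWithinAt ℝ (fun ϑ => (P ϑ).real B) Θ θ)
    (hl : ∀ φ, ∃ l, IsLogDeriv P Θ θ φ l ∧ MemLp l 2 (P θ)) : ∃! J, IsFisherInfo P Θ θ J := by
  obtain ⟨T, hT⟩ := exists_clm_isLogDeriv hl
  obtain ⟨J, hJ⟩ := exists_gram T
  have fisher_J : IsFisherInfo P Θ θ J := by
    refine ⟨hP, fun φ => T φ, hT, fun φ => Lp.memLp _, fun φ χ => ?_⟩
    rw [hJ, L2.inner_def]
    simp only [RCLike.inner_apply, conj_trivial, mul_comm]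
  exact ⟨J, fisher_J, fun K hK => hK.unique fisher_J⟩

end ClassicalFisher

section Measurement

variable {H : Type*} [NormedAddCommGroup H] [InnerProductSpace ℂ H] [CompleteSpace H]
  {Ξ : Type*} [NormedAddCommGroup Ξ] [InnerProductSpace ℝ Ξ]

namespace HasTraceFDerivWithinAt

variable {ρ : Ξ → H →L[ℂ] H} {D : Ξ →ₗ[ℝ] (H →L[ℂ] H)} {Θ : Set Ξ} {θ : Ξ}

theorem isTraceClass (h : HasTraceFDerivWithinAt ρ D Θ θ) (φ : Ξ) : IsTraceClass (D φ) :=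
  (h.bounded.choose_spec φ).trans_lt ENNReal.ofReal_lt_top

theorem exists_traceNorm_le (h : HasTraceFDerivWithinAt ρ D Θ θ) :
    ∃ C : ℝ, ∀ φ, (traceNorm (D φ)).toReal ≤ C * ‖φ‖ := by
  obtain ⟨C, hC⟩ := h.bounded
  refine ⟨|C|, fun φ => ENNReal.toReal_le_of_le_ofReal (by positivity) ((hC φ).trans ?_)⟩
  gcongr
  exact le_abs_self C

theorem continuous (h : HasTraceFDerivWithinAt ρ D Θ θ) : Continuous D := by
  obtain ⟨C, hC⟩ := h.exists_traceNorm_le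
  exact AddMonoidHomClass.continuous_of_bound D C fun φ =>
    (h.isTraceClass φ).norm_le.trans (hC φ)

theorem exists_clm_eq_trace_mul (h : HasTraceFDerivWithinAt ρ D Θ θ) (X : H →L[ℂ] H) :
    ∃ L : Ξ →L[ℝ] ℂ, ∀ φ, L φ = trace (D φ * X) := by
  obtain ⟨C, hC⟩ := h.exists_traceNorm_le
  have hsum (φ : Ξ) : DiagSummable (D φ * X) := (h.isTraceClass φ).diagSummable_mul X
  refine ⟨LinearMap.mkContinuous
    { toFun := fun φ => trace (D φ * X)
      map_add' := fun φ χ => by rw [map_add, add_mul, trace_add (hsum φ) (hsum χ)]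
      map_smul' := fun c φ => ?_ } (C * ‖X‖) fun φ => ?_, fun φ => rfl⟩
  · rw [map_smul, smul_mul_assoc, ← Complex.coe_smul c, trace_smul, RingHom.id_apply,
      Complex.real_smul]
  · calc ‖trace (D φ * X)‖ ≤ (traceNorm (D φ)).toReal * ‖X‖ :=
          (h.isTraceClass φ).norm_trace_mul_le X
      _ ≤ C * ‖φ‖ * ‖X‖ := by gcongr; exact hC φ
      _ = C * ‖X‖ * ‖φ‖ := mul_right_comm ..

theorem hasFDerivWithinAt_trace_mul (h : HasTraceFDerivWithinAt ρ D Θ θ)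
    (hρ : ∀ ϑ ∈ Θ, IsTraceClass (ρ ϑ)) (hθ : θ ∈ Θ) {X : H →L[ℂ] H} {L : Ξ →L[ℝ] ℂ}
    (hL : ∀ φ, L φ = trace (D φ * X)) :
    HasFDerivWithinAt (fun ϑ => trace (ρ ϑ * X)) L Θ θ := by
  refine .of_isLittleO (Asymptotics.isLittleO_iff.2 fun c hc => ?_)
  filter_upwards [h.isLittleO (c / (‖X‖ + 1)) (by positivity), self_mem_nhdsWithin] with ϑ hR hϑ
  set R := ρ ϑ - ρ θ - D (ϑ - θ)
  have remainder_eq : trace (ρ ϑ * X) - trace (ρ θ * X) - L (ϑ - θ) = trace (R * X) := by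
    have hsum₁ := (hρ ϑ hϑ).diagSummable_mul X
    have hsum₂ := (hρ θ hθ).diagSummable_mul X
    rw [hL, sub_mul, sub_mul, trace_sub (hsum₁.sub hsum₂) ((h.isTraceClass _).diagSummable_mul X),
      trace_sub hsum₁ hsum₂]
  have hX : ‖X‖ / (‖X‖ + 1) ≤ 1 := div_le_one_of_le₀ (by linarith) (by positivity)
  calc ‖trace (ρ ϑ * X) - trace (ρ θ * X) - L (ϑ - θ)‖
      = ‖trace (R * X)‖ := by rw [remainder_eq]
    _ ≤ (traceNorm R).toReal * ‖X‖ :=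
        IsTraceClass.norm_trace_mul_le (hR.trans_lt ENNReal.ofReal_lt_top) X
    _ ≤ c / (‖X‖ + 1) * ‖ϑ - θ‖ * ‖X‖ := by
        gcongr; exact ENNReal.toReal_le_of_le_ofReal (by positivity) hR
    _ = c * ‖ϑ - θ‖ * (‖X‖ / (‖X‖ + 1)) := by ring
    _ ≤ c * ‖ϑ - θ‖ := mul_le_of_le_one_right (by positivity) hX

end HasTraceFDerivWithinAt

namespace Model

variable {Ω : Type*} [MeasurableSpace Ω] {S : Model H Ξ} {θ : Ξ} {M : POVM Ω H}
  {P : Ξ → Measure Ω}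

theorem isOutcomeLaw_law (S : Model H Ξ) (M : POVM Ω H) :
    S.IsOutcomeLaw M fun ϑ => M.law (S.ρ ϑ) := fun ϑ hϑ =>
  ⟨M.isProbabilityMeasure_law (S.isDensity ϑ hϑ),
    fun _ hB => M.ofReal_law_real (S.isDensity ϑ hϑ) hB⟩

theorem IsOutcomeLaw.eq_law (hP : S.IsOutcomeLaw M P) (hθ : θ ∈ S.Θ) :
    P θ = M.law (S.ρ θ) := by
  have := (hP θ hθ).1
  have := M.isProbabilityMeasure_law (S.isDensity θ hθ)
  refine Measure.ext fun B hB => (measureReal_eq_measureReal_iff).1 (Complex.ofReal_inj.1 ?_)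
  rw [(hP θ hθ).2 B hB, M.ofReal_law_real (S.isDensity θ hθ) hB]

theorem IsOutcomeLaw.hasFDerivWithinAt (hP : S.IsOutcomeLaw M P) (hθ : θ ∈ S.Θ) {B : Set Ω}
    (hB : MeasurableSet B) :
    ∃ L : Ξ →L[ℝ] ℝ, HasFDerivWithinAt (fun ϑ => (P ϑ).real B) L S.Θ θ ∧
      ∀ φ, (L φ : ℂ) = trace (S.D θ φ * M.toFun B) := by
  obtain ⟨L, hL⟩ := (S.hasDeriv θ hθ).exists_clm_eq_trace_mul (M.toFun B)
  have hcomplex : HasFDerivWithinAt (fun ϑ => ((P ϑ).real B : ℂ)) L S.Θ θ :=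
    ((S.hasDeriv θ hθ).hasFDerivWithinAt_trace_mul (fun ϑ hϑ => (S.isDensity ϑ hϑ).isTraceClass)
      hθ hL).congr (fun ϑ hϑ => (hP ϑ hϑ).2 B hB) ((hP θ hθ).2 B hB)
  have hreal : HasFDerivWithinAt (fun ϑ => (P ϑ).real B) (Complex.reCLM ∘L L) S.Θ θ :=
    Complex.reCLM.hasFDerivAt.comp_hasFDerivWithinAt θ hcomplex
  have hL_real : L = Complex.ofRealCLM ∘L Complex.reCLM ∘L L :=
    (S.uniqueDiff θ hθ).eq hcomplex (Complex.ofRealCLM.hasFDerivAt.comp_hasFDerivWithinAt θ hreal)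
  exact ⟨_, hreal, fun φ => (DFunLike.congr_fun hL_real φ).symm.trans (hL φ)⟩

theorem IsOutcomeLaw.differentiableWithinAt (hP : S.IsOutcomeLaw M P) (hθ : θ ∈ S.Θ) {B : Set Ω}
    (hB : MeasurableSet B) : DifferentiableWithinAt ℝ (fun ϑ => (P ϑ).real B) S.Θ θ :=
  let ⟨_, hL, _⟩ := hP.hasFDerivWithinAt hθ hB
  hL.differentiableWithinAt

theorem IsOutcomeLaw.ofReal_fderivWithin (hP : S.IsOutcomeLaw M P) (hθ : θ ∈ S.Θ) {B : Set Ω}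
    (hB : MeasurableSet B) (φ : Ξ) :
    (fderivWithin ℝ (fun ϑ => (P ϑ).real B) S.Θ θ φ : ℂ) = trace (S.D θ φ * M.toFun B) := by
  obtain ⟨L, hL, hL_eq⟩ := hP.hasFDerivWithinAt hθ hB
  rw [hL.fderivWithin (S.uniqueDiff θ hθ), hL_eq]

end Model

end Measurement

section HSOperator

variable {H : Type*} [NormedAddCommGroup H] [InnerProductSpace ℂ H] [CompleteSpace H]

theorem norm_sum_inner_smul_le (v : HSSpace H) (x : H) (s : Finset (basisIndex H)) :
    ‖∑ i ∈ s, ⟪stdBasis H i, x⟫_ℂ • v i‖ ≤ ‖v‖ * ‖x‖ := by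
  have hv : ∑ i ∈ s, ‖v i‖ ^ 2 ≤ ‖v‖ ^ 2 := by
    simpa using lp.sum_rpow_le_norm_rpow (p := 2) (by simp) v s
  have hx : ∑ i ∈ s, ‖⟪stdBasis H i, x⟫_ℂ‖ ^ 2 ≤ ‖x‖ ^ 2 :=
    sum_le_hasSum s (fun _ _ => by positivity) (hasSum_norm_inner_stdBasis_sq x)
  calc ‖∑ i ∈ s, ⟪stdBasis H i, x⟫_ℂ • v i‖
      ≤ ∑ i ∈ s, ‖v i‖ * ‖⟪stdBasis H i, x⟫_ℂ‖ :=
        norm_sum_le_of_le s fun i _ => by rw [norm_smul, mul_comm]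
    _ ≤ √(∑ i ∈ s, ‖v i‖ ^ 2) * √(∑ i ∈ s, ‖⟪stdBasis H i, x⟫_ℂ‖ ^ 2) :=
        Real.sum_mul_le_sqrt_mul_sqrt _ _ _
    _ ≤ ‖v‖ * ‖x‖ := by
        gcongr
        · exact (Real.sqrt_le_left (norm_nonneg _)).2 hv
        · exact (Real.sqrt_le_left (norm_nonneg _)).2 hx

theorem hasSum_inner_smul (v : HSSpace H) (x : H) :
    HasSum (fun i => ⟪stdBasis H i, x⟫_ℂ • v i) (∑' i, ⟪stdBasis H i, x⟫_ℂ • v i) := by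
  have hv : Summable fun i => ‖v i‖ ^ 2 := by
    simpa using (lp.memℓp v).summable (by simp)
  refine (Summable.of_norm_bounded (hv.add (hasSum_norm_inner_stdBasis_sq x).summable)
    fun i => ?_).hasSum
  rw [norm_smul]
  nlinarith [sq_nonneg (‖⟪stdBasis H i, x⟫_ℂ‖ - ‖v i‖), sq_nonneg ‖v i‖,
    sq_nonneg ‖⟪stdBasis H i, x⟫_ℂ‖]

/-- The operator with prescribed square summable values `v i` on the basis vectors
`stdBasis H i`; this inverts `IsHilbertSchmidt.vec`. -/
def HSSpace.toOperator : HSSpace H →L[ℂ] H →L[ℂ] H :=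
  LinearMap.mkContinuous₂
    (LinearMap.mk₂ ℂ (fun (v : HSSpace H) x => ∑' i, ⟪stdBasis H i, x⟫_ℂ • v i)
      (fun v w x => by
        rw [← ((hasSum_inner_smul v x).add (hasSum_inner_smul w x)).tsum_eq]
        simp [smul_add])
      (fun c v x => by
        rw [← ((hasSum_inner_smul v x).const_smul c).tsum_eq]
        simp [smul_comm c])
      (fun v x y => by
        rw [← ((hasSum_inner_smul v x).add (hasSum_inner_smul v y)).tsum_eq]
        simp [add_smul])
      (fun c v x => by
        rw [← ((hasSum_inner_smul v x).const_smul c).tsum_eq]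
        simp [mul_smul]))
    1 fun v x => by
      rw [one_mul]
      exact le_of_tendsto (hasSum_inner_smul v x).norm
        (Eventually.of_forall (norm_sum_inner_smul_le v x))

namespace HSSpace

theorem hasSum_toOperator (v : HSSpace H) (x : H) :
    HasSum (fun i => ⟪stdBasis H i, x⟫_ℂ • v i) (toOperator v x) :=
  hasSum_inner_smul v x

open scoped Classical in
theorem toOperator_stdBasis (v : HSSpace H) (i : basisIndex H) :
    toOperator v (stdBasis H i) = v i := by
  refine (hasSum_toOperator v (stdBasis H i)).unique ?_
  convert hasSum_single i fun j hj => ?_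
  · rw [orthonormal_iff_ite.1 (stdBasis H).orthonormal, if_pos rfl, one_smul]
  · rw [(stdBasis H).orthonormal.inner_eq_zero hj, zero_smul]

theorem isHilbertSchmidt_toOperator (v : HSSpace H) : IsHilbertSchmidt (toOperator v) := by
  simpa [IsHilbertSchmidt, toOperator_stdBasis] using (lp.memℓp v).summable (by simp)

theorem vec_toOperator (v : HSSpace H) : (isHilbertSchmidt_toOperator v).vec = v :=
  Subtype.ext (funext (toOperator_stdBasis v))

theorem hsInner_toOperator (v w : HSSpace H) :
    hsInner (toOperator v) (toOperator w) = ⟪v, w⟫_ℂ := by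
  rw [← (isHilbertSchmidt_toOperator v).inner_vec (isHilbertSchmidt_toOperator w),
    vec_toOperator, vec_toOperator]

theorem toOperator_vec {A : H →L[ℂ] H} (hA : IsHilbertSchmidt A) : toOperator hA.vec = A := by
  ext x
  refine (hasSum_toOperator hA.vec x).unique ?_
  have h := ((stdBasis H).hasSum_repr x).mapL A
  simp only [map_smul, (stdBasis H).repr_apply_apply] at h
  exact h

end HSSpace

theorem exists_clm_hsSpace_of_total {Ξ F : Type*} [NormedAddCommGroup Ξ] [NormedSpace ℝ Ξ]
    [CompleteSpace Ξ] [NormedAddCommGroup F] [NormedSpace ℝ F] (K : Ξ × (H →L[ℂ] H) →L[ℝ] F)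
    (total : ∀ φ, ∃ A, IsHilbertSchmidt A ∧ K (φ, A) = 0)
    (single_valued : ∀ A, IsHilbertSchmidt A → K (0, A) = 0 → A = 0) :
    ∃ T : Ξ →L[ℝ] HSSpace H, ∀ φ, K (φ, HSSpace.toOperator (T φ)) = 0 := by
  let K' : Ξ × HSSpace H →L[ℝ] F := K ∘L
    (ContinuousLinearMap.id ℝ Ξ).prodMap (HSSpace.toOperator.restrictScalars ℝ)
  refine exists_clm_of_isClosed_graph K'.ker K'.isClosed_ker (fun φ => ?_) fun v hv => ?_
  · obtain ⟨A, hA, hK⟩ := total φ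
    exact ⟨hA.vec, show K (φ, HSSpace.toOperator hA.vec) = 0 by rwa [HSSpace.toOperator_vec]⟩
  · have h := single_valued _ (HSSpace.isHilbertSchmidt_toOperator v) hv
    refine Subtype.ext (funext fun i => ?_)
    rw [← HSSpace.toOperator_stdBasis, h]
    rfl

end HSOperator

section LogarithmicDerivative

variable {H : Type*} [NormedAddCommGroup H] [InnerProductSpace ℂ H] [CompleteSpace H]
  {r d d' A A' X : H →L[ℂ] H}

theorem sqrt_injective (hr : 0 ≤ r) (hr0 : IsStrictlyPos r) :
    Function.Injective (CFC.sqrt r : H →L[ℂ] H) := by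
  refine (injective_iff_map_eq_zero _).2 fun x hx => by_contra fun hx0 => ?_
  have hpos := hr0 x hx0
  rw [← norm_sqrt_apply_sq hr, hx] at hpos
  simp at hpos

theorem eq_zero_of_sqrt_mul_eq_zero (hr : 0 ≤ r) (hr0 : IsStrictlyPos r)
    (h : CFC.sqrt r * A = 0) : A = 0 :=
  ContinuousLinearMap.ext fun x => sqrt_injective hr hr0 <| by simpa using DFunLike.congr_fun h x

theorem eq_zero_of_mul_eq_neg_mul (hr : 0 ≤ r) (hr0 : IsStrictlyPos r) (h : r * A = -(A * r)) :
    A = 0 := by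
  have commute_sq : Commute (r * r) A := by
    rw [Commute, SemiconjBy, mul_assoc, h, mul_neg, ← mul_assoc, h, neg_mul, neg_neg, mul_assoc]
  have commute : Commute r A := by
    have := commute_sq.cfcₙ_nnreal NNReal.sqrt
    rwa [← CFC.sqrt, CFC.sqrt_mul_self r hr] at this
  have add_self : r * A + r * A = 0 := by
    rw [← eq_neg_iff_add_eq_zero]
    exact h.trans (congrArg Neg.neg commute.eq.symm)
  have mul_eq_zero : r * A = 0 :=
    (smul_eq_zero.1 ((two_smul ℂ (r * A)).trans add_self)).resolve_left two_ne_zero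
  rw [← CFC.sqrt_mul_sqrt_self r hr, mul_assoc] at mul_eq_zero
  exact eq_zero_of_sqrt_mul_eq_zero hr hr0 (eq_zero_of_sqrt_mul_eq_zero hr hr0 mul_eq_zero)

theorem IsSLD.eq_zero (hr : 0 ≤ r) (hr0 : IsStrictlyPos r) (h : IsSLD r 0 A) : A = 0 := by
  have star_mul_sqrt : star A * CFC.sqrt r = CFC.sqrt r * A := by
    simpa [star_sqrt] using h.isSelfAdjoint.star_eq
  have sqrt_mul_star : CFC.sqrt r * star A = -(A * CFC.sqrt r) :=
    eq_neg_of_add_eq_zero_left ((smul_eq_zero.1 h.eqn).resolve_left (by norm_num))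
  refine eq_zero_of_mul_eq_neg_mul hr hr0 ?_
  calc r * A = CFC.sqrt r * star A * CFC.sqrt r := by
        rw [mul_assoc, star_mul_sqrt, ← mul_assoc, CFC.sqrt_mul_sqrt_self r hr]
    _ = -(A * r) := by
        rw [sqrt_mul_star, neg_mul, mul_assoc, CFC.sqrt_mul_sqrt_self r hr]

theorem IsRLD.eq_zero (hr : 0 ≤ r) (hr0 : IsStrictlyPos r) (h : IsRLD r 0 A) : A = 0 :=
  eq_zero_of_sqrt_mul_eq_zero hr hr0 h.eqn

theorem IsSLD.sub (h : IsSLD r d A) (h' : IsSLD r d' A') : IsSLD r (d - d') (A - A') where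
  isHilbertSchmidt := by
    simpa [sub_eq_add_neg] using h.isHilbertSchmidt.add (h'.isHilbertSchmidt.const_smul (-1))
  isSelfAdjoint := by rw [mul_sub]; exact h.isSelfAdjoint.sub h'.isSelfAdjoint
  eqn := by rw [← h.eqn, ← h'.eqn, star_sub, mul_sub, sub_mul, ← smul_sub]; congr 1; abel

theorem IsRLD.add (h : IsRLD r d A) (h' : IsRLD r d' A') : IsRLD r (d + d') (A + A') where
  isHilbertSchmidt := h.isHilbertSchmidt.add h'.isHilbertSchmidt
  eqn := by rw [mul_add, h.eqn, h'.eqn]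

theorem IsRLD.smul (c : ℂ) (h : IsRLD r d A) : IsRLD r (c • d) (c • A) where
  isHilbertSchmidt := h.isHilbertSchmidt.const_smul c
  eqn := by rw [mul_smul_comm, h.eqn]

theorem IsSLD.unique (hr : 0 ≤ r) (hr0 : IsStrictlyPos r) (h : IsSLD r d A)
    (h' : IsSLD r d A') : A = A' :=
  sub_eq_zero.1 (IsSLD.eq_zero hr hr0 (by simpa using h.sub h'))

theorem IsRLD.unique (hr : 0 ≤ r) (hr0 : IsStrictlyPos r) (h : IsRLD r d A)
    (h' : IsRLD r d A') : A = A' :=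
  sub_eq_zero.1 (IsRLD.eq_zero hr hr0 (by simpa [sub_eq_add_neg] using h.add (h'.smul (-1))))

theorem IsSLD.trace_mul (hr : IsDensity r) (h : IsSLD r d A) (hX : IsSelfAdjoint X) :
    trace (d * X) = (hsInner A (X * CFC.sqrt r)).re := by
  have hs := hr.isHilbertSchmidt_sqrt
  have hA := h.isHilbertSchmidt
  have left_term : trace (CFC.sqrt r * (star A * X)) = hsInner A (X * CFC.sqrt r) := by
    rw [trace_mul_comm hs (hA.star.mul_right X), mul_assoc, trace_mul_eq_hsInner, star_star]
  have right_term : trace (A * (CFC.sqrt r * X)) = hsInner (X * CFC.sqrt r) A := by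
    rw [trace_mul_eq_hsInner, ← hsInner_star hA (hs.mul_left X), star_mul, star_sqrt, hX.star_eq]
  rw [← h.eqn, smul_mul_assoc, trace_smul, add_mul, mul_assoc, mul_assoc,
    trace_add (hs.diagSummable_mul (hA.star.mul_right X)) (hA.diagSummable_mul (hs.mul_right X)),
    left_term, right_term, ← conj_hsInner A, Complex.add_conj]
  simp

theorem IsRLD.trace_mul (hr : IsDensity r) (h : IsRLD r d A) (X : H →L[ℂ] H) :
    trace (d * X) = hsInner (star A) (X * CFC.sqrt r) := by
  rw [← h.eqn, mul_assoc, trace_mul_comm hr.isHilbertSchmidt_sqrt (h.isHilbertSchmidt.mul_right X),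
    mul_assoc, trace_mul_eq_hsInner]

end LogarithmicDerivative

/-! ### Quantum Fisher information and the Cramér–Rao inequalities -/

section FisherInformation

theorem le_of_isSymmetric_of_re_inner_le {𝕜 E : Type*} [RCLike 𝕜] [NormedAddCommGroup E]
    [InnerProductSpace 𝕜 E] {J J' : E →L[𝕜] E} (hJ : (J : E →ₗ[𝕜] E).IsSymmetric)
    (hJ' : (J' : E →ₗ[𝕜] E).IsSymmetric)
    (h : ∀ φ, RCLike.re ⟪φ, J φ⟫_𝕜 ≤ RCLike.re ⟪φ, J' φ⟫_𝕜) : J ≤ J' := by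
  refine (ContinuousLinearMap.le_def _ _).2
    (ContinuousLinearMap.isPositive_def.2 ⟨hJ'.sub hJ, fun φ => ?_⟩)
  rw [ContinuousLinearMap.reApplyInnerSelf_apply, inner_re_symm, sub_apply, inner_sub_right,
    map_sub, sub_nonneg]
  exact h φ

variable {H : Type*} [NormedAddCommGroup H] [InnerProductSpace ℂ H] [CompleteSpace H]
  {Ξ : Type*} [NormedAddCommGroup Ξ] [InnerProductSpace ℝ Ξ] {Ω : Type*} [MeasurableSpace Ω]

theorem IsLogDeriv.congr {P P' : Ξ → Measure Ω} {Θ : Set Ξ} {θ φ : Ξ} {l : Ω → ℝ}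
    (hl : IsLogDeriv P Θ θ φ l) (h : Set.EqOn P P' Θ) (hθ : θ ∈ Θ) :
    IsLogDeriv P' Θ θ φ l where
  integrable := h hθ ▸ hl.integrable
  eqn B hB := by
    rw [← h hθ, ← hl.eqn B hB]
    exact DFunLike.congr_fun
      (fderivWithin_congr (fun ϑ hϑ => by rw [h hϑ]) (by rw [h hθ])) φ

theorem IsFisherInfo.congr {P P' : Ξ → Measure Ω} {Θ : Set Ξ} {θ : Ξ} {J : Ξ →L[ℝ] Ξ}
    (hJ : IsFisherInfo P Θ θ J) (h : Set.EqOn P P' Θ) (hθ : θ ∈ Θ) : IsFisherInfo P' Θ θ J := by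
  obtain ⟨hP, l, hl, hl2, inner_J⟩ := hJ
  refine ⟨fun B hB => (hP B hB).congr (fun ϑ hϑ => by rw [h hϑ]) (by rw [h hθ]), l,
    fun φ => (hl φ).congr h hθ, h hθ ▸ hl2, h hθ ▸ inner_J⟩

theorem POVM.exists_density_hsInner (M : POVM Ω H) {Z C : H →L[ℂ] H} (hZ : IsHilbertSchmidt Z)
    (hC : IsHilbertSchmidt C) :
    ∃ l : Ω → ℂ, MemLp l 2 (M.hsMeasure C) ∧
      ∀ B, MeasurableSet B → ∫ ω in B, l ω ∂(M.hsMeasure C) = hsInner Z (M.toFun B * C) := by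
  have := M.isFiniteMeasure_hsMeasure hZ
  have := M.isFiniteMeasure_hsMeasure hC
  obtain ⟨l, hl, density, -⟩ := exists_density_of_norm_sq_le
    (ν := fun B => hsInner Z (M.toFun B * C))
    (fun B B' hB hB' hd => by
      rw [M.map_union hB hB' hd, add_mul,
        hsInner_add_right hZ (hC.mul_left _) (hC.mul_left _)])
    (fun B hB => M.norm_hsInner_mul_sq_le hZ hC hB)
  exact ⟨l, hl, density⟩

namespace Model

variable {S : Model H Ξ} {θ φ : Ξ} {M : POVM Ω H} {J : Ξ →L[ℝ] Ξ}

theorem isMeasFisher_iff (hθ : θ ∈ S.Θ) :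
    S.IsMeasFisher θ M J ↔ IsFisherInfo (fun ϑ => M.law (S.ρ ϑ)) S.Θ θ J :=
  ⟨fun ⟨_, hP, hJ⟩ => hJ.congr (fun _ hϑ => hP.eq_law hϑ) hθ,
    fun hJ => ⟨_, S.isOutcomeLaw_law M, hJ⟩⟩

theorem isLogDeriv_law_iff (hθ : θ ∈ S.Θ) {l : Ω → ℝ} :
    IsLogDeriv (fun ϑ => M.law (S.ρ ϑ)) S.Θ θ φ l ↔ Integrable l (M.law (S.ρ θ)) ∧
      ∀ B, MeasurableSet B →
        ((∫ ω in B, l ω ∂(M.law (S.ρ θ)) : ℝ) : ℂ) = trace (S.D θ φ * M.toFun B) := by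
  have deriv_eq {B : Set Ω} (hB : MeasurableSet B) :=
    (S.isOutcomeLaw_law M).ofReal_fderivWithin hθ hB φ
  refine ⟨fun hl => ⟨hl.integrable, fun B hB => ?_⟩, fun ⟨hl, h⟩ => ⟨hl, fun B hB => ?_⟩⟩
  · rw [← deriv_eq hB, hl.eqn B hB]
  · rw [← Complex.ofReal_inj, deriv_eq hB, h B hB]

theorem exists_isLogDeriv_law (hθ : θ ∈ S.Θ) {Z : H →L[ℂ] H} (hZ : IsHilbertSchmidt Z)
    (h : ∀ B, MeasurableSet B →
      (trace (S.D θ φ * M.toFun B)).re = (hsInner Z (M.toFun B * CFC.sqrt (S.ρ θ))).re) :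
    ∃ l, IsLogDeriv (fun ϑ => M.law (S.ρ ϑ)) S.Θ θ φ l ∧ MemLp l 2 (M.law (S.ρ θ)) := by
  have hr := S.isDensity θ hθ
  have := M.isFiniteMeasure_hsMeasure hr.isHilbertSchmidt_sqrt
  obtain ⟨l, hl, density⟩ := M.exists_density_hsInner hZ hr.isHilbertSchmidt_sqrt
  refine ⟨fun ω => (l ω).re, ⟨(hl.integrable one_le_two).re, fun B hB => ?_⟩, hl.re⟩
  calc fderivWithin ℝ (fun ϑ => (M.law (S.ρ ϑ)).real B) S.Θ θ φ
      = (trace (S.D θ φ * M.toFun B)).re := by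
        rw [← (S.isOutcomeLaw_law M).ofReal_fderivWithin hθ hB, Complex.ofReal_re]
    _ = (∫ ω in B, l ω ∂(M.law (S.ρ θ))).re := by rw [h B hB, ← density B hB]; rfl
    _ = ∫ ω in B, (l ω).re ∂(M.law (S.ρ θ)) :=
        (integral_re (hl.integrable one_le_two).integrableOn).symm

theorem HasSLD.existsUnique_isMeasFisher [CompleteSpace Ξ] (h : S.HasSLD θ) (hθ : θ ∈ S.Θ)
    (M : POVM Ω H) : ∃! J, S.IsMeasFisher θ M J := by
  have hr := S.isDensity θ hθ
  have := M.isProbabilityMeasure_law hr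
  simp only [isMeasFisher_iff hθ]
  refine existsUnique_isFisherInfo
    (fun B hB => (S.isOutcomeLaw_law M).differentiableWithinAt hθ hB) fun φ => ?_
  obtain ⟨A, hA⟩ := h φ
  exact exists_isLogDeriv_law hθ hA.isHilbertSchmidt fun B hB => by
    rw [hA.trace_mul hr (M.isPositive B hB).isSelfAdjoint, Complex.ofReal_re]

theorem HasRLD.existsUnique_isMeasFisher [CompleteSpace Ξ] (h : S.HasRLD θ) (hθ : θ ∈ S.Θ)
    (M : POVM Ω H) : ∃! J, S.IsMeasFisher θ M J := by
  have hr := S.isDensity θ hθ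
  have := M.isProbabilityMeasure_law hr
  simp only [isMeasFisher_iff hθ]
  refine existsUnique_isFisherInfo
    (fun B hB => (S.isOutcomeLaw_law M).differentiableWithinAt hθ hB) fun φ => ?_
  obtain ⟨Y, hY⟩ := h φ
  exact exists_isLogDeriv_law hθ hY.isHilbertSchmidt.star fun _ _ => by rw [hY.trace_mul hr]

theorem HasSLD.exists_clm [CompleteSpace Ξ] (h : S.HasSLD θ) (hθ : θ ∈ S.Θ) :
    ∃ T : Ξ →L[ℝ] HSSpace H, ∀ φ, IsSLD (S.ρ θ) (S.D θ φ) (HSSpace.toOperator (T φ)) := by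
  have hD : Continuous (S.D θ) := (S.hasDeriv θ hθ).continuous
  set s := CFC.sqrt (S.ρ θ) with hs
  let K : Ξ × (H →L[ℂ] H) →L[ℝ] (H →L[ℂ] H) × (H →L[ℂ] H) :=
    { toFun := fun p => (star (s * p.2) - s * p.2,
        (2⁻¹ : ℂ) • (s * star p.2 + p.2 * s) - S.D θ p.1)
      map_add' := fun p q => by
        ext1 <;> simp only [Prod.fst_add, Prod.snd_add, map_add, mul_add, add_mul, star_add,
          smul_add] <;> abel
      map_smul' := fun c p => by
        ext1 <;> simp [smul_sub, smul_comm c]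
      cont := by fun_prop }
  have K_eq_zero {φ A} : K (φ, A) = 0 ↔
      star (s * A) = s * A ∧ (2⁻¹ : ℂ) • (s * star A + A * s) = S.D θ φ := by
    simp only [K, ContinuousLinearMap.coe_mk', LinearMap.coe_mk, AddHom.coe_mk, Prod.mk_eq_zero,
      sub_eq_zero]
  obtain ⟨T, hT⟩ := exists_clm_hsSpace_of_total K
    (fun φ => (h φ).imp fun A hA => ⟨hA.isHilbertSchmidt, K_eq_zero.2 ⟨hA.isSelfAdjoint, hA.eqn⟩⟩)
    (fun A hA hK => IsSLD.eq_zero (S.isDensity θ hθ).nonneg (S.isStrictlyPos θ hθ)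
      ⟨hA, (K_eq_zero.1 hK).1, by rw [← hs, (K_eq_zero.1 hK).2, map_zero]⟩)
  exact ⟨T, fun φ => ⟨HSSpace.isHilbertSchmidt_toOperator _, (K_eq_zero.1 (hT φ)).1,
    (K_eq_zero.1 (hT φ)).2⟩⟩

theorem HasRLD.exists_clm [CompleteSpace Ξ] (h : S.HasRLD θ) (hθ : θ ∈ S.Θ) :
    ∃ T : Ξ →L[ℝ] HSSpace H, ∀ φ, IsRLD (S.ρ θ) (S.D θ φ) (HSSpace.toOperator (T φ)) := by
  have hD : Continuous (S.D θ) := (S.hasDeriv θ hθ).continuous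
  set s := CFC.sqrt (S.ρ θ) with hs
  let K : Ξ × (H →L[ℂ] H) →L[ℝ] H →L[ℂ] H :=
    { toFun := fun p => s * p.2 - S.D θ p.1
      map_add' := fun p q => by
        simp only [Prod.fst_add, Prod.snd_add, map_add, mul_add]; abel
      map_smul' := fun c p => by simp [smul_sub]
      cont := by fun_prop }
  have K_eq_zero {φ A} : K (φ, A) = 0 ↔ s * A = S.D θ φ := sub_eq_zero
  obtain ⟨T, hT⟩ := exists_clm_hsSpace_of_total K
    (fun φ => (h φ).imp fun Y hY => ⟨hY.isHilbertSchmidt, K_eq_zero.2 hY.eqn⟩)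
    (fun A hA hK => IsRLD.eq_zero (S.isDensity θ hθ).nonneg (S.isStrictlyPos θ hθ)
      ⟨hA, by rw [← hs, K_eq_zero.1 hK, map_zero]⟩)
  exact ⟨T, fun φ => ⟨HSSpace.isHilbertSchmidt_toOperator _, K_eq_zero.1 (hT φ)⟩⟩

theorem HasSLD.existsUnique_isSLDFisher [CompleteSpace Ξ] (h : S.HasSLD θ) (hθ : θ ∈ S.Θ) :
    ∃! J, S.IsSLDFisher θ J := by
  obtain ⟨T, hT⟩ := h.exists_clm hθ
  let _ : InnerProductSpace ℝ (HSSpace H) := InnerProductSpace.complexToReal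
  obtain ⟨J, hJ⟩ := exists_gram T
  have inner_J (φ χ) : ⟪φ, J χ⟫_ℝ =
      (hsInner (HSSpace.toOperator (T φ)) (HSSpace.toOperator (T χ))).re := by
    rw [hJ, HSSpace.hsInner_toOperator]; rfl
  refine ⟨J, ⟨_, hT, inner_J⟩, ?_⟩
  rintro J' ⟨A, hA, inner_J'⟩
  obtain rfl : A = fun φ => HSSpace.toOperator (T φ) := funext fun φ =>
    (hA φ).unique (S.isDensity θ hθ).nonneg (S.isStrictlyPos θ hθ) (hT φ)
  exact clm_ext_inner fun φ χ => by rw [inner_J', inner_J]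

theorem isSymmetric_of_isMeasFisher (hJ : S.IsMeasFisher θ M J) :
    (J : Ξ →ₗ[ℝ] Ξ).IsSymmetric := fun φ χ => by
  obtain ⟨P, -, hJ⟩ := hJ
  simpa [real_inner_comm] using hJ.symm χ φ

theorem IsSLDFisher.isSymmetric (hJ : S.IsSLDFisher θ J) : (J : Ξ →ₗ[ℝ] Ξ).IsSymmetric := by
  obtain ⟨A, -, inner_J⟩ := hJ
  intro φ χ
  rw [ContinuousLinearMap.coe_coe, real_inner_comm, inner_J, inner_J, ← conj_hsInner,
    Complex.conj_re]

theorem IsMeasFisher.le_of_isSLDFisher {JS : Ξ →L[ℝ] Ξ} (hJ : S.IsMeasFisher θ M J)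
    (hθ : θ ∈ S.Θ) (hJS : S.IsSLDFisher θ JS) : J ≤ JS := by
  refine le_of_isSymmetric_of_re_inner_le (isSymmetric_of_isMeasFisher hJ) hJS.isSymmetric
    fun φ => ?_
  obtain ⟨-, l, hl, -, inner_J⟩ := (isMeasFisher_iff hθ).1 hJ
  obtain ⟨A, hA, inner_JS⟩ := hJS
  have hr := S.isDensity θ hθ
  have := M.isProbabilityMeasure_law hr
  have := M.isFiniteMeasure_hsMeasure (hA φ).isHilbertSchmidt
  obtain ⟨hint, setIntegral_l⟩ := (isLogDeriv_law_iff hθ).1 (hl φ)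
  have cauchy_schwarz (B : Set Ω) (hB : MeasurableSet B) :
      ‖∫ ω in B, l φ ω ∂(M.law (S.ρ θ))‖ ^ 2
        ≤ (M.hsMeasure (A φ)).real B * (M.law (S.ρ θ)).real B := by
    refine le_trans ?_ (M.norm_hsInner_mul_sq_le (hA φ).isHilbertSchmidt
      hr.isHilbertSchmidt_sqrt hB)
    gcongr
    rw [← Complex.norm_real, setIntegral_l B hB,
      (hA φ).trace_mul hr (M.isPositive B hB).isSelfAdjoint, Complex.norm_real]
    exact Complex.abs_re_le_norm _
  calc ⟪φ, J φ⟫_ℝ = ∫ ω, ‖l φ ω‖ ^ 2 ∂(M.law (S.ρ θ)) := by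
        simp only [inner_J, ← sq, Real.norm_eq_abs, sq_abs]
    _ ≤ (M.hsMeasure (A φ)).real Set.univ :=
        (memLp_and_integral_norm_sq_le_of_setIntegral hint cauchy_schwarz).2
    _ = ⟪φ, JS φ⟫_ℝ := by
        rw [M.hsMeasure_real_univ (hA φ).isHilbertSchmidt, inner_JS,
          hsInner_self (hA φ).isHilbertSchmidt, Complex.ofReal_re]

end Model

section Complexification

variable {E : Type*} [NormedAddCommGroup E] [InnerProductSpace ℂ E]

instance [CompleteSpace Ξ] : CompleteSpace (Cx Ξ) :=
  inferInstanceAs (CompleteSpace (WithLp 2 (Ξ × Ξ)))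

theorem Cx.norm_re_le (φ : Cx Ξ) : ‖φ.re‖ ≤ ‖φ‖ :=
  le_of_sq_le_sq (by rw [Cx.norm_sq φ]; linarith [sq_nonneg ‖φ.im‖]) (norm_nonneg _)

theorem Cx.norm_im_le (φ : Cx Ξ) : ‖φ.im‖ ≤ ‖φ‖ :=
  le_of_sq_le_sq (by rw [Cx.norm_sq φ]; linarith [sq_nonneg ‖φ.re‖]) (norm_nonneg _)

/-- The complex linear extension to the complexification of a bounded real linear map into a complex
Hilbert space. -/
def Cx.lift (T : Ξ →L[ℝ] E) : Cx Ξ →L[ℂ] E :=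
  LinearMap.mkContinuous
    { toFun := fun φ => T φ.re + Complex.I • T φ.im
      map_add' := fun φ χ => by
        simp only [Cx.re_add, Cx.im_add, map_add, smul_add]; abel
      map_smul' := fun z φ => by
        simp only [Cx.re_smul, Cx.im_smul, map_add, map_sub, map_smul, ← Complex.coe_smul,
          RingHom.id_apply]
        match_scalars
        · linear_combination z.re_add_im
        · linear_combination Complex.I * z.re_add_im - (z.im : ℂ) * Complex.I_mul_I }
    (2 * ‖T‖) fun φ => by
      calc ‖T φ.re + Complex.I • T φ.im‖ ≤ ‖T φ.re‖ + ‖T φ.im‖ := by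
            simpa [norm_smul] using norm_add_le (T φ.re) (Complex.I • T φ.im)
        _ ≤ ‖T‖ * ‖φ‖ + ‖T‖ * ‖φ‖ := by
            gcongr
            · exact T.le_opNorm_of_le φ.norm_re_le
            · exact T.le_opNorm_of_le φ.norm_im_le
        _ = 2 * ‖T‖ * ‖φ‖ := by ring

theorem inner_add_I_smul (a b c d : E) : ⟪a + Complex.I • b, c + Complex.I • d⟫_ℂ =
    ⟪a, c⟫_ℂ + Complex.I * ⟪a, d⟫_ℂ - Complex.I * ⟪b, c⟫_ℂ + ⟪b, d⟫_ℂ := by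
  simp only [inner_add_left, inner_add_right, inner_smul_left, inner_smul_right, Complex.conj_I]
  linear_combination (-⟪b, d⟫_ℂ) * Complex.I_mul_I

theorem Cx.isSymmetric_map {J : Ξ →L[ℝ] Ξ} (hJ : (J : Ξ →ₗ[ℝ] Ξ).IsSymmetric) :
    (Cx.map J : Cx Ξ →ₗ[ℂ] Cx Ξ).IsSymmetric := fun φ χ => by
  have inner_J (a b : Ξ) : ⟪J a, b⟫_ℝ = ⟪a, J b⟫_ℝ := hJ a b
  simp [Cx.inner_def, inner_J]

theorem Cx.re_inner_map (J : Ξ →L[ℝ] Ξ) (φ : Cx Ξ) :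
    (⟪φ, Cx.map J φ⟫_ℂ).re = ⟪φ.re, J φ.re⟫_ℝ + ⟪φ.im, J φ.im⟫_ℝ := rfl

end Complexification

namespace Model

variable {S : Model H Ξ} {θ : Ξ} {M : POVM Ω H} {J : Ξ →L[ℝ] Ξ}

theorem HasRLD.existsUnique_isRLDFisher [CompleteSpace Ξ] (h : S.HasRLD θ) (hθ : θ ∈ S.Θ) :
    ∃! J, S.IsRLDFisher θ J := by
  obtain ⟨T, hT⟩ := h.exists_clm hθ
  obtain ⟨J, hJ⟩ := exists_gram (Cx.lift T)
  have inner_J (φ χ : Cx Ξ) : ⟪φ, J χ⟫_ℂ = ⟪T φ.re, T χ.re⟫_ℂ + Complex.I * ⟪T φ.re, T χ.im⟫_ℂ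
      - Complex.I * ⟪T φ.im, T χ.re⟫_ℂ + ⟪T φ.im, T χ.im⟫_ℂ :=
    (hJ φ χ).trans (inner_add_I_smul _ _ _ _)
  refine ⟨J, ⟨_, hT, fun φ χ => ?_⟩, ?_⟩
  · simp only [inner_J, HSSpace.hsInner_toOperator]
  rintro J' ⟨Y, hY, inner_J'⟩
  obtain rfl : Y = fun φ => HSSpace.toOperator (T φ) := funext fun φ =>
    (hY φ).unique (S.isDensity θ hθ).nonneg (S.isStrictlyPos θ hθ) (hT φ)
  exact clm_ext_inner fun φ χ => by
    simp only [inner_J', inner_J, HSSpace.hsInner_toOperator]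

theorem IsRLDFisher.exists_eq_hsInner {JR : Cx Ξ →L[ℂ] Cx Ξ} (hJR : S.IsRLDFisher θ JR) :
    ∃ Y : Cx Ξ → H →L[ℂ] H,
      (∀ φ, IsRLD (S.ρ θ) (S.D θ φ.re + Complex.I • S.D θ φ.im) (Y φ)) ∧
      ∀ φ χ, ⟪φ, JR χ⟫_ℂ = hsInner (Y φ) (Y χ) := by
  obtain ⟨Y, hY, inner_JR⟩ := hJR
  have hYc (φ : Cx Ξ) := (hY φ.re).add ((hY φ.im).smul Complex.I)
  refine ⟨fun φ => Y φ.re + Complex.I • Y φ.im, hYc, fun φ χ => ?_⟩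
  have hHS (φ : Ξ) := (hY φ).isHilbertSchmidt
  rw [inner_JR, ← (hYc φ).isHilbertSchmidt.inner_vec (hYc χ).isHilbertSchmidt]
  simp only [← (hHS _).inner_vec (hHS _)]
  exact (inner_add_I_smul _ _ _ _).symm

theorem IsRLDFisher.isSymmetric {JR : Cx Ξ →L[ℂ] Cx Ξ} (hJR : S.IsRLDFisher θ JR) :
    (JR : Cx Ξ →ₗ[ℂ] Cx Ξ).IsSymmetric := by
  obtain ⟨Y, -, inner_JR⟩ := hJR.exists_eq_hsInner
  intro φ χ
  rw [ContinuousLinearMap.coe_coe, ← inner_conj_symm, inner_JR, inner_JR, conj_hsInner]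

theorem setIntegral_add_I_mul_eq_trace (hθ : θ ∈ S.Θ) {φ χ : Ξ} {l m : Ω → ℝ}
    (hl : IsLogDeriv (fun ϑ => M.law (S.ρ ϑ)) S.Θ θ φ l)
    (hm : IsLogDeriv (fun ϑ => M.law (S.ρ ϑ)) S.Θ θ χ m) {B : Set Ω} (hB : MeasurableSet B) :
    ∫ ω in B, ((l ω : ℂ) + Complex.I * m ω) ∂(M.law (S.ρ θ))
      = trace ((S.D θ φ + Complex.I • S.D θ χ) * M.toFun B) := by
  obtain ⟨hl, setIntegral_l⟩ := (isLogDeriv_law_iff hθ).1 hl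
  obtain ⟨hm, setIntegral_m⟩ := (isLogDeriv_law_iff hθ).1 hm
  have hsum (ψ : Ξ) : DiagSummable (S.D θ ψ * M.toFun B) :=
    ((S.hasDeriv θ hθ).isTraceClass ψ).diagSummable_mul _
  have hl' : Integrable (fun ω => (l ω : ℂ)) (M.law (S.ρ θ)) := hl.ofReal
  have hm' : Integrable (fun ω => Complex.I * (m ω : ℂ)) (M.law (S.ρ θ)) :=
    hm.ofReal.const_mul _
  rw [integral_add hl'.restrict hm'.restrict, integral_const_mul, integral_complex_ofReal,
    integral_complex_ofReal, setIntegral_l B hB,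
    setIntegral_m B hB, add_mul, smul_mul_assoc, trace_add (hsum φ) ((hsum χ).smul _), trace_smul]

theorem IsMeasFisher.map_le_of_isRLDFisher {JR : Cx Ξ →L[ℂ] Cx Ξ} (hJ : S.IsMeasFisher θ M J)
    (hθ : θ ∈ S.Θ) (hJR : S.IsRLDFisher θ JR) : Cx.map J ≤ JR := by
  refine le_of_isSymmetric_of_re_inner_le (Cx.isSymmetric_map (isSymmetric_of_isMeasFisher hJ))
    hJR.isSymmetric fun φ => ?_
  obtain ⟨-, l, hl, hl2, inner_J⟩ := (isMeasFisher_iff hθ).1 hJ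
  obtain ⟨Y, hY, inner_JR⟩ := hJR.exists_eq_hsInner
  have hr := S.isDensity θ hθ
  have hYHS := (hY φ).isHilbertSchmidt
  have := M.isProbabilityMeasure_law hr
  have := M.isFiniteMeasure_hsMeasure hYHS.star
  let lc (ω : Ω) : ℂ := l φ.re ω + Complex.I * l φ.im ω
  have hint : Integrable lc (M.law (S.ρ θ)) :=
    (hl φ.re).integrable.ofReal.add ((hl φ.im).integrable.ofReal.const_mul _)
  have cauchy_schwarz (B : Set Ω) (hB : MeasurableSet B) :
      ‖∫ ω in B, lc ω ∂(M.law (S.ρ θ))‖ ^ 2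
        ≤ (M.hsMeasure (star (Y φ))).real B * (M.law (S.ρ θ)).real B := by
    rw [setIntegral_add_I_mul_eq_trace hθ (hl φ.re) (hl φ.im) hB, (hY φ).trace_mul hr]
    exact M.norm_hsInner_mul_sq_le hYHS.star hr.isHilbertSchmidt_sqrt hB
  have norm_lc_sq (ω : Ω) : ‖lc ω‖ ^ 2 = l φ.re ω * l φ.re ω + l φ.im ω * l φ.im ω := by
    simp [lc, Complex.sq_norm, Complex.normSq_apply]
  calc (⟪φ, Cx.map J φ⟫_ℂ).re = ∫ ω, ‖lc ω‖ ^ 2 ∂(M.law (S.ρ θ)) := by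
        simp only [norm_lc_sq]
        rw [Cx.re_inner_map, inner_J, inner_J]
        exact (integral_add ((hl2 φ.re).integrable_mul (hl2 φ.re))
          ((hl2 φ.im).integrable_mul (hl2 φ.im))).symm
    _ ≤ (M.hsMeasure (star (Y φ))).real Set.univ :=
        (memLp_and_integral_norm_sq_le_of_setIntegral hint cauchy_schwarz).2
    _ = (⟪φ, JR φ⟫_ℂ).re := by
        rw [M.hsMeasure_real_univ hYHS.star, hsNorm_star hYHS, inner_JR, hsInner_self hYHS,
          Complex.ofReal_re]

end Model

end FisherInformation

/-! ### The spectral measure of a representation of `C(X)` -/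

section WeakLimits

variable {K : Type*} [NormedAddCommGroup K] [InnerProductSpace ℂ K] [CompleteSpace K]

theorem inner_apply_polarization (T : K →L[ℂ] K) (x y : K) : ⟪x, T y⟫_ℂ =
    (⟪x + y, T (x + y)⟫_ℂ - ⟪x - y, T (x - y)⟫_ℂ
      - Complex.I * ⟪x + Complex.I • y, T (x + Complex.I • y)⟫_ℂ
      + Complex.I * ⟪x - Complex.I • y, T (x - Complex.I • y)⟫_ℂ) / 4 := by
  simpa only [ContinuousLinearMap.coe_coe, ContinuousLinearMap.adjoint_inner_left] using
    inner_map_polarization' (ContinuousLinearMap.adjoint T : K →ₗ[ℂ] K) x y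

theorem exists_clm_of_tendsto_inner_self {ι : Type*} {F : Filter ι} [F.NeBot]
    {T : ι → K →L[ℂ] K} {C : ℝ} (hC : ∀ n, ‖T n‖ ≤ C) {q : K → ℂ}
    (hT : ∀ x, Tendsto (fun n => ⟪x, T n x⟫_ℂ) F (𝓝 (q x))) :
    ∃ E : K →L[ℂ] K, ∀ x, ⟪x, E x⟫_ℂ = q x := by
  have exists_limit (x y : K) : ∃ c, Tendsto (fun n => ⟪x, T n y⟫_ℂ) F (𝓝 c) := by
    simp only [inner_apply_polarization (T _) x y]
    exact ⟨_, ((((hT _).sub (hT _)).sub ((hT _).const_mul _)).add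
      ((hT _).const_mul _)).div_const 4⟩
  choose β hβ using exists_limit
  let b : K →ₗ⋆[ℂ] K →ₗ[ℂ] ℂ := LinearMap.mk₂'ₛₗ (starRingEnd ℂ) (RingHom.id ℂ) β
    (fun x y z => tendsto_nhds_unique (hβ _ _) <| ((hβ x z).add (hβ y z)).congr fun n => by
      rw [inner_add_left])
    (fun c x y => tendsto_nhds_unique (hβ _ _) <| ((hβ x y).const_mul _).congr fun n => by
      rw [inner_smul_left])
    (fun x y z => tendsto_nhds_unique (hβ _ _) <| ((hβ x y).add (hβ x z)).congr fun n => by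
      rw [map_add, inner_add_right])
    (fun c x y => tendsto_nhds_unique (hβ _ _) <| ((hβ x y).const_mul _).congr fun n => by
      rw [map_smul, inner_smul_right, RingHom.id_apply])
  have norm_b_le (x y : K) : ‖b x y‖ ≤ C * ‖x‖ * ‖y‖ :=
    le_of_tendsto (hβ x y).norm <| Eventually.of_forall fun n =>
      calc ‖⟪x, T n y⟫_ℂ‖ ≤ ‖x‖ * (C * ‖y‖) :=
            (norm_inner_le_norm _ _).trans <| by gcongr; exact (T n).le_of_opNorm_le (hC n) y
        _ = C * ‖x‖ * ‖y‖ := by ring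
  refine ⟨ContinuousLinearMap.adjoint
    (InnerProductSpace.continuousLinearMapOfBilin (b.mkContinuous₂ C norm_b_le)), fun x => ?_⟩
  rw [ContinuousLinearMap.adjoint_inner_right,
    InnerProductSpace.continuousLinearMapOfBilin_apply]
  exact tendsto_nhds_unique (hβ x x) (hT x)

end WeakLimits

section MeasureFamilies

theorem POVM.exists_measure_eq {Ω : Type*} [MeasurableSpace Ω] {K : Type*} [NormedAddCommGroup K]
    [InnerProductSpace ℂ K] [CompleteSpace K] {μ : K → Measure Ω} [∀ x, IsFiniteMeasure (μ x)]
    (measure_univ : ∀ x, (μ x).real Set.univ = ‖x‖ ^ 2)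
    (exists_effect : ∀ B, MeasurableSet B →
      ∃ E : K →L[ℂ] K, ∀ x, ⟪x, E x⟫_ℂ = ((μ x).real B : ℂ)) :
    ∃ M : POVM Ω K, M.measure = μ := by
  choose! E inner_E using exists_effect
  let M : POVM Ω K :=
    { toFun := E
      isPositive := fun B hB => (ContinuousLinearMap.isPositive_iff_complex _).2 fun x => by
        rw [← inner_conj_symm, inner_E B hB, Complex.conj_ofReal]
        exact ⟨by simp, by simp [measureReal_nonneg]⟩
      map_univ := eq_of_forall_inner_self_eq fun x => by
        rw [inner_E _ MeasurableSet.univ, measure_univ, one_apply_eq_self,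
          inner_self_eq_norm_sq_to_K]
        simp
      hasSum_iUnion := fun B hB hd x y => by
        have hasSum_self (z : K) :
            HasSum (fun n => ⟪z, E (B n) z⟫_ℂ) ⟪z, E (⋃ n, B n) z⟫_ℂ := by
          simp only [inner_E _ (hB _), inner_E _ (MeasurableSet.iUnion hB)]
          refine Complex.hasSum_ofReal.2 ?_
          simp only [measureReal_def]
          rw [measure_iUnion hd hB, ENNReal.tsum_toReal_eq fun n => measure_ne_top _ _]
          exact ENNReal.hasSum_toReal (measure_iUnion hd hB ▸ measure_ne_top _ _)
        simp only [inner_apply_polarization _ x y]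
        exact ((((hasSum_self _).sub (hasSum_self _)).sub ((hasSum_self _).mul_left _)).add
          ((hasSum_self _).mul_left _)).div_const 4 }
  refine ⟨M, funext fun x => Measure.ext fun B hB => (measureReal_eq_measureReal_iff).1 ?_⟩
  rw [← Complex.ofReal_inj, M.ofReal_measure_real x hB]
  exact inner_E B hB x

theorem exists_continuousMap_abs_integral_sub_le {X : Type*} [TopologicalSpace X]
    [TopologicalSpace.PseudoMetrizableSpace X] [MeasurableSpace X] [BorelSpace X]
    {ι : Type*} {μ : ι → Measure X} [∀ i, IsFiniteMeasure (μ i)] {B : Set X} (hB : MeasurableSet B)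
    (s : Finset ι) {ε : ℝ} (hε : 0 < ε) :
    ∃ f : C(X, ℝ), (∀ z, f z ∈ Set.Icc 0 1) ∧
      ∀ i ∈ s, |∫ z, f z ∂(μ i) - (μ i).real B| ≤ ε := by
  let ν : Measure X := ∑ i ∈ s, μ i
  have hB_int (m : Measure X) [IsFiniteMeasure m] : Integrable (B.indicator fun _ => (1 : ℝ)) m :=
    (integrable_const 1).indicator hB
  obtain ⟨g, hg, hg_int⟩ := (hB_int ν).exists_boundedContinuous_integral_sub_le hε
  let f : C(X, ℝ) := ⟨fun z => Set.projIcc 0 1 zero_le_one (g z), by fun_prop⟩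
  have f_mem (z : X) : f z ∈ Set.Icc 0 1 := (Set.projIcc 0 1 zero_le_one (g z)).2
  have f_int (m : Measure X) [IsFiniteMeasure m] : Integrable f m :=
    (integrable_const (1 : ℝ)).mono' (by fun_prop) (Eventually.of_forall fun z => by
      rw [Real.norm_eq_abs, abs_of_nonneg (f_mem z).1]; exact (f_mem z).2)
  have abs_clip_sub_le (z : X) : |f z - B.indicator (fun _ => 1) z|
      ≤ ‖B.indicator (fun _ => (1 : ℝ)) z - g z‖ := by
    have h01 : B.indicator (fun _ => (1 : ℝ)) z ∈ Set.Icc 0 1 := by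
      by_cases hz : z ∈ B <;> simp [hz]
    rw [norm_sub_rev]
    calc _ = |(f z : ℝ) - Set.projIcc 0 1 zero_le_one (B.indicator (fun _ => (1 : ℝ)) z)| := by
          rw [Set.projIcc_of_mem _ h01]
      _ ≤ _ := Set.abs_projIcc_sub_projIcc _
  refine ⟨f, f_mem, fun i hi => ?_⟩
  have μ_le : μ i ≤ ν := Finset.single_le_sum (f := μ) (fun _ _ => bot_le) hi
  calc |∫ z, f z ∂(μ i) - (μ i).real B|
      = |∫ z, (f z - B.indicator (fun _ => 1) z) ∂(μ i)| := by
        rw [integral_sub (f_int _) (hB_int _), integral_indicator hB]; simp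
    _ ≤ ∫ z, |f z - B.indicator (fun _ => 1) z| ∂(μ i) := abs_integral_le_integral_abs
    _ ≤ ∫ z, |f z - B.indicator (fun _ => 1) z| ∂ν :=
        integral_mono_measure μ_le (Eventually.of_forall fun _ => abs_nonneg _)
          ((f_int ν).sub (hB_int ν)).abs
    _ ≤ ∫ z, ‖B.indicator (fun _ => (1 : ℝ)) z - g z‖ ∂ν :=
        integral_mono ((f_int ν).sub (hB_int ν)).abs ((hB_int ν).sub hg_int).norm abs_clip_sub_le
    _ ≤ ε := hg

end MeasureFamilies

section Spectral

open CompactlySupported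

variable {K : Type*} [NormedAddCommGroup K] [InnerProductSpace ℂ K] [CompleteSpace K]
  {X : Type*} [MetricSpace X]

/-- A real continuous function as a complex one. -/
def toCx (f : C(X, ℝ)) : C(X, ℂ) := ⟨fun x => (f x : ℂ), by fun_prop⟩

theorem toCx_apply (f : C(X, ℝ)) (x : X) : toCx f x = (f x : ℂ) := rfl

theorem star_toCx (f : C(X, ℝ)) : star (toCx f) = toCx f := by
  ext x; simp [toCx_apply]

variable (Φ : C(X, ℂ) →⋆ₐ[ℂ] (K →L[ℂ] K))

theorem re_inner_toCx_nonneg {f : C(X, ℝ)} (hf : 0 ≤ f) (x : K) :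
    0 ≤ (⟪x, Φ (toCx f) x⟫_ℂ).re := by
  let g : C(X, ℝ) := ⟨fun z => √(f z), by fun_prop⟩
  have eq_star_mul_self : toCx f = star (toCx g) * toCx g := by
    rw [star_toCx]
    ext z
    rw [ContinuousMap.mul_apply, toCx_apply, toCx_apply, ← Complex.ofReal_mul]
    exact congrArg _ (Real.mul_self_sqrt (hf z)).symm
  rw [eq_star_mul_self, map_mul, map_star, mul_apply_eq_comp, inner_apply_star]
  exact inner_self_nonneg (𝕜 := ℂ)

theorem ofReal_re_inner_toCx (f : C(X, ℝ)) (x : K) :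
    (((⟪x, Φ (toCx f) x⟫_ℂ).re : ℝ) : ℂ) = ⟪x, Φ (toCx f) x⟫_ℂ := by
  refine Complex.conj_eq_iff_re.1 ?_
  rw [inner_conj_symm, ← inner_apply_star, ← map_star, star_toCx]

/-- The positive functional `f ↦ ⟪x, Φ(f) x⟫` on real functions, which represents the spectral
measure of the vector `x`. -/
def spectralFunctional (x : K) : C_c(X, ℝ) →ₚ[ℝ] ℝ :=
  PositiveLinearMap.mk₀
    { toFun := fun f => (⟪x, Φ (toCx f.toContinuousMap) x⟫_ℂ).re
      map_add' := fun f g => by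
        have toCx_add : toCx (f + g).toContinuousMap
            = toCx f.toContinuousMap + toCx g.toContinuousMap := by
          ext z; simp [toCx_apply]
        rw [toCx_add, map_add, add_apply, inner_add_right, Complex.add_re]
      map_smul' := fun c f => by
        have toCx_smul : toCx (c • f).toContinuousMap = (c : ℂ) • toCx f.toContinuousMap := by
          ext z; simp [toCx_apply]
        rw [toCx_smul, map_smul, smul_apply, inner_smul_right, Complex.re_ofReal_mul]
        rfl }
    fun f hf => re_inner_toCx_nonneg Φ (f := f.toContinuousMap) hf x

variable [CompactSpace X] [MeasurableSpace X] [BorelSpace X]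

/-- The spectral measure `μ` of the vector `x`, characterized by `∫ f dμ = ⟪x, Φ(f) x⟫`. -/
def spectralMeasure (x : K) : Measure X := RealRMK.rieszMeasure (spectralFunctional Φ x)

instance (x : K) : IsFiniteMeasure (spectralMeasure Φ x) :=
  inferInstanceAs (IsFiniteMeasure (RealRMK.rieszMeasure (spectralFunctional Φ x)))

theorem integral_spectralMeasure (x : K) (f : C(X, ℝ)) :
    ∫ z, f z ∂(spectralMeasure Φ x) = (⟪x, Φ (toCx f) x⟫_ℂ).re :=
  RealRMK.integral_rieszMeasure (spectralFunctional Φ x)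
    (CompactlySupportedContinuousMap.continuousMapEquiv f)

theorem eq_spectralMeasure {μ : Measure X} [IsFiniteMeasure μ] {x : K}
    (h : ∀ f : C(X, ℝ), ∫ z, f z ∂μ = (⟪x, Φ (toCx f) x⟫_ℂ).re) : μ = spectralMeasure Φ x :=
  Measure.ext_of_integral_eq_on_compactlySupported fun f =>
    (h f.toContinuousMap).trans (integral_spectralMeasure Φ x f.toContinuousMap).symm

theorem spectralMeasure_real_univ (x : K) : (spectralMeasure Φ x).real Set.univ = ‖x‖ ^ 2 := by
  have toCx_one : toCx (1 : C(X, ℝ)) = 1 := by ext; simp [toCx_apply]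
  calc (spectralMeasure Φ x).real Set.univ = ∫ _, (1 : ℝ) ∂(spectralMeasure Φ x) := by simp
    _ = (⟪x, Φ (toCx 1) x⟫_ℂ).re := integral_spectralMeasure Φ x 1
    _ = (⟪x, x⟫_ℂ).re := by rw [toCx_one, map_one, one_apply_eq_self]
    _ = ‖x‖ ^ 2 := inner_self_eq_norm_sq (𝕜 := ℂ) x

theorem spectralMeasure_apply_eq_withDensity (g : C(X, ℂ)) (x : K) :
    spectralMeasure Φ (Φ g x) =
      (spectralMeasure Φ x).withDensity fun z => ENNReal.ofReal (‖g z‖ ^ 2) := by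
  have norm_sq_int : Integrable (fun z => ‖g z‖ ^ 2) (spectralMeasure Φ x) :=
    (show Continuous fun z => ‖g z‖ ^ 2 by fun_prop).integrable_of_hasCompactSupport
      (HasCompactSupport.of_compactSpace _)
  have := isFiniteMeasure_withDensity_ofReal norm_sq_int.2
  refine (eq_spectralMeasure Φ fun f => ?_).symm
  let F : C(X, ℝ) := ⟨fun z => ‖g z‖ ^ 2 * f z, by fun_prop⟩
  have toCx_F : toCx F = star g * (toCx f * g) := by
    ext z
    change ((‖g z‖ ^ 2 * f z : ℝ) : ℂ) = starRingEnd ℂ (g z) * ((f z : ℂ) * g z)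
    push_cast
    linear_combination (-(f z : ℂ)) * Complex.conj_mul' (g z)
  calc ∫ z, f z ∂((spectralMeasure Φ x).withDensity fun z => ENNReal.ofReal (‖g z‖ ^ 2))
      = ∫ z, F z ∂(spectralMeasure Φ x) := by
        rw [integral_withDensity_eq_integral_toReal_smul (by fun_prop) (by simp)]
        simp only [ENNReal.toReal_ofReal (sq_nonneg _), smul_eq_mul]
        rfl
    _ = (⟪Φ g x, Φ (toCx f) (Φ g x)⟫_ℂ).re := by
        rw [integral_spectralMeasure, toCx_F, map_mul, map_mul, map_star, mul_apply_eq_comp,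
          mul_apply_eq_comp, inner_apply_star]

theorem exists_clm_inner_self_eq_spectralMeasure {B : Set X} (hB : MeasurableSet B) :
    ∃ E : K →L[ℂ] K, ∀ x, ⟪x, E x⟫_ℂ = ((spectralMeasure Φ x).real B : ℂ) := by
  classical
  choose f f_mem abs_integral_sub_le using fun p : Finset K × ℕ =>
    exists_continuousMap_abs_integral_sub_le (μ := spectralMeasure Φ) hB p.1
      (Nat.one_div_pos_of_nat (α := ℝ) (n := p.2))
  refine exists_clm_of_tendsto_inner_self (F := atTop) (T := fun p => Φ (toCx (f p))) (C := 1)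
    (fun p => ?_) fun x => ?_
  · refine (NonUnitalStarAlgHom.norm_apply_le Φ _).trans
      ((ContinuousMap.norm_le _ zero_le_one).2 fun z => ?_)
    rw [toCx_apply, Complex.norm_real, Real.norm_eq_abs, abs_of_nonneg (f_mem p z).1]
    exact (f_mem p z).2
  · refine Tendsto.congr (fun p => ofReal_re_inner_toCx Φ (f p) x)
      ((Complex.continuous_ofReal.tendsto _).comp ?_)
    simp only [← integral_spectralMeasure]
    rw [tendsto_iff_norm_sub_tendsto_zero]
    refine squeeze_zero' (Eventually.of_forall fun _ => norm_nonneg _) ?_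
      ((tendsto_one_div_add_atTop_nhds_zero_nat (𝕜 := ℝ)).comp
        (prod_atTop_atTop_eq (α := Finset K) (β := ℕ) ▸ tendsto_snd))
    filter_upwards [eventually_ge_atTop ({x}, 0)] with p hp
    exact abs_integral_sub_le p x (hp.1 (Finset.mem_singleton_self x))

theorem exists_povm_measure_eq_spectralMeasure :
    ∃ E : POVM X K, E.measure = spectralMeasure Φ :=
  POVM.exists_measure_eq (spectralMeasure_real_univ Φ) fun _ hB =>
    exists_clm_inner_self_eq_spectralMeasure Φ hB

end Spectral

/-! ### Diagonalizing a symmetric operator by a measurement -/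

section Dilation

variable {H : Type*} [NormedAddCommGroup H] [InnerProductSpace ℂ H]

/-- The operator on `H ⊕ H` given by a matrix of operators. -/
def blockOp (a b c d : H →L[ℂ] H) : WithLp 2 (H × H) →L[ℂ] WithLp 2 (H × H) :=
  (WithLp.prodContinuousLinearEquiv 2 ℂ H H).symm.toContinuousLinearMap ∘L
    ((a ∘L ContinuousLinearMap.fst ℂ H H + b ∘L ContinuousLinearMap.snd ℂ H H).prod
      (c ∘L ContinuousLinearMap.fst ℂ H H + d ∘L ContinuousLinearMap.snd ℂ H H)) ∘L
    (WithLp.prodContinuousLinearEquiv 2 ℂ H H).toContinuousLinearMap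

theorem blockOp_apply (a b c d : H →L[ℂ] H) (x : WithLp 2 (H × H)) :
    blockOp a b c d x = WithLp.toLp 2 (a x.fst + b x.snd, c x.fst + d x.snd) := rfl

theorem blockOp_mul (a b c d a' b' c' d' : H →L[ℂ] H) :
    blockOp a b c d * blockOp a' b' c' d' =
      blockOp (a * a' + b * c') (a * b' + b * d') (c * a' + d * c') (c * b' + d * d') := by
  refine ContinuousLinearMap.ext fun x => ?_
  simp only [blockOp_apply, add_apply, mul_apply_eq_comp, map_add, WithLp.fst, WithLp.snd]
  congr 2 <;> abel

theorem blockOp_one : blockOp (1 : H →L[ℂ] H) 0 0 1 = 1 := by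
  refine ContinuousLinearMap.ext fun x => ?_
  simp only [blockOp_apply, one_apply_eq_self, zero_apply, add_zero, zero_add]
  rfl

variable (H) in
/-- The embedding `x ↦ (x, 0)` of `H` in `H ⊕ H`. -/
def inlIsometry : H →ₗᵢ[ℂ] WithLp 2 (H × H) where
  toFun x := WithLp.toLp 2 (x, 0)
  map_add' x y := by rw [← WithLp.toLp_add, Prod.mk_add_mk, add_zero]
  map_smul' c x := by rw [RingHom.id_apply, ← WithLp.toLp_smul, Prod.smul_mk, smul_zero]
  norm_map' x := by
    rw [← sq_eq_sq₀ (norm_nonneg _) (norm_nonneg _), WithLp.prod_norm_sq_eq_of_L2]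
    simp

variable [CompleteSpace H]

theorem star_blockOp (a b c d : H →L[ℂ] H) :
    star (blockOp a b c d) = blockOp (star a) (star c) (star b) (star d) := by
  refine ContinuousLinearMap.ext fun y => ext_inner_left ℂ fun x => ?_
  rw [inner_apply_star]
  simp only [inner_apply_star, blockOp_apply, WithLp.prod_inner_apply, inner_add_left,
    inner_add_right, WithLp.fst, WithLp.snd]
  ring

/-- The Halmos dilation of a partial isometry `C` to `H ⊕ H`: its off-diagonal entries are the
projections `1 - C C*` and `1 - C* C`, which are their own square roots. -/
def halmosDilation (C : H →L[ℂ] H) : WithLp 2 (H × H) →L[ℂ] WithLp 2 (H × H) :=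
  blockOp C (1 - C * star C) (1 - star C * C) (-star C)

theorem star_halmosDilation (C : H →L[ℂ] H) :
    star (halmosDilation C) = halmosDilation (star C) := by
  simp only [halmosDilation, star_blockOp, star_sub, star_one, star_mul, star_star, star_neg]

theorem halmosDilation_mul_star {C : H →L[ℂ] H} (hC : C * star C * C = C) :
    halmosDilation C * halmosDilation (star C) = 1 := by
  have star_hC : star C * C * star C = star C := by
    simpa only [star_mul, star_star, mul_assoc] using congrArg star hC
  rw [halmosDilation, halmosDilation, blockOp_mul, ← blockOp_one]
  congr 1 <;>
  · simp only [star_star, mul_sub, sub_mul, mul_one, one_mul, ← mul_assoc, hC, star_hC, mul_neg,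
      neg_mul]
    abel

theorem halmosDilation_mem_unitary {C : H →L[ℂ] H} (hC : C * star C * C = C) :
    halmosDilation C ∈ unitary (WithLp 2 (H × H) →L[ℂ] WithLp 2 (H × H)) := by
  have star_hC : star C * star (star C) * star C = star C := by
    simpa only [star_mul, star_star, mul_assoc] using congrArg star hC
  rw [Unitary.mem_iff, star_halmosDilation]
  exact ⟨by simpa only [star_star] using halmosDilation_mul_star star_hC,
    halmosDilation_mul_star hC⟩

theorem exists_unitary_inlIsometry {F G : H →L[ℂ] H} (h : ∀ x, ‖F x‖ = ‖G x‖) :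
    ∃ U ∈ unitary (WithLp 2 (H × H) →L[ℂ] WithLp 2 (H × H)),
      ∀ x, U (inlIsometry H (G x)) = inlIsometry H (F x) := by
  obtain ⟨C, hCG, initial_G, hC, -⟩ := exists_partialIsometry h
  have C_apply (x : H) : C (G x) = F x := DFunLike.congr_fun hCG x
  have star_C_apply (x : H) : star C (F x) = G x := by
    rw [← C_apply]; exact DFunLike.congr_fun initial_G x
  refine ⟨halmosDilation C, halmosDilation_mem_unitary hC, fun x => ?_⟩
  change WithLp.toLp 2 (C (G x) + (1 - C * star C) 0, (1 - star C * C) (G x) + (-star C) 0) =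
    WithLp.toLp 2 (F x, (0 : H))
  simp only [map_zero, add_zero, sub_apply, one_apply_eq_self, mul_apply_eq_comp, C_apply,
    star_C_apply, sub_self]

end Dilation

section Representation

variable {K : Type*} [NormedAddCommGroup K] [InnerProductSpace ℂ K] [CompleteSpace K]

/- The spectrum of `U` lives in `Type 0`; lifting it makes measurements with outcomes in any
universe available. -/
theorem exists_starAlgHom_apply_eq_of_mem_unitary {U : K →L[ℂ] K}
    (hU : U ∈ unitary (K →L[ℂ] K)) :
    ∃ (X : Type w) (_ : MetricSpace X) (_ : CompactSpace X) (_ : MeasurableSpace X)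
      (_ : BorelSpace X) (Φ : C(X, ℂ) →⋆ₐ[ℂ] (K →L[ℂ] K)) (ζ : C(X, ℂ)),
      Φ ζ = U ∧ ∀ z, ‖ζ z‖ = 1 := by
  obtain ⟨star_mul_U, mul_star_U⟩ := Unitary.mem_iff.1 hU
  have normal : IsStarNormal U := ⟨star_mul_U.trans mul_star_U.symm⟩
  have : CompactSpace (spectrum ℂ U) := isCompact_iff_compactSpace.1 (spectrum.isCompact U)
  let _ : MeasurableSpace (ULift.{w} (spectrum ℂ U)) := borel _
  refine ⟨ULift.{w} (spectrum ℂ U), inferInstance, inferInstance, borel _, ⟨rfl⟩,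
    (cfcHom normal).comp (ContinuousMap.compStarAlgHom' ℂ ℂ ⟨ULift.up, continuous_uliftUp⟩),
    ⟨fun z => (z.down : ℂ), continuous_subtype_val.comp continuous_uliftDown⟩,
    cfcHom_id normal, fun z => ?_⟩
  exact mem_sphere_zero_iff_norm.1 (spectrum.subset_circle_of_unitary hU z.down.2)

end Representation

section Compression

variable {H : Type*} [NormedAddCommGroup H] [InnerProductSpace ℂ H] [CompleteSpace H]
  {K : Type*} [NormedAddCommGroup K] [InnerProductSpace ℂ K] [CompleteSpace K]
  {Ω : Type*} [MeasurableSpace Ω]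

/-- The compression `B ↦ ι* E(B) ι` of a positive operator-valued measure to a subspace. -/
def POVM.compress (E : POVM Ω K) (ι : H →ₗᵢ[ℂ] K) : POVM Ω H where
  toFun B := ContinuousLinearMap.adjoint ι.toContinuousLinearMap ∘L E.toFun B ∘L
    ι.toContinuousLinearMap
  isPositive B hB := (E.isPositive B hB).adjoint_conj _
  map_univ := by
    refine ContinuousLinearMap.ext fun x => ext_inner_left ℂ fun y => ?_
    rw [E.map_univ, ContinuousLinearMap.comp_apply, ContinuousLinearMap.adjoint_inner_right]
    exact ι.inner_map_map y x
  hasSum_iUnion B hB hd x y := by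
    simp only [ContinuousLinearMap.comp_apply, ContinuousLinearMap.adjoint_inner_right]
    exact E.hasSum_iUnion B hB hd _ _

theorem POVM.measure_compress (E : POVM Ω K) (ι : H →ₗᵢ[ℂ] K) (x : H) :
    (E.compress ι).measure x = E.measure (ι x) := by
  refine Measure.ext fun B hB => ?_
  rw [POVM.measure_apply _ _ hB, POVM.measure_apply _ _ hB]
  exact congrArg (fun c : ℂ => ENNReal.ofReal c.re)
    (ContinuousLinearMap.adjoint_inner_right _ x (E.toFun B (ι x)))

theorem POVM.apply_eq_zero (M : POVM Ω H) {B : Set Ω} (hB : MeasurableSet B) {x : H}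
    (h : M.measure x B = 0) : M.toFun B x = 0 := by
  have nonneg : 0 ≤ M.toFun B := (ContinuousLinearMap.nonneg_iff_isPositive _).2 (M.isPositive _ hB)
  have sqrt_apply : CFC.sqrt (M.toFun B) x = 0 := by
    rw [M.measure_apply x hB, ENNReal.ofReal_eq_zero, ← norm_sqrt_apply_sq nonneg] at h
    exact norm_eq_zero.1 (pow_eq_zero_iff two_ne_zero |>.1 (le_antisymm h (sq_nonneg _)))
  rw [← CFC.sqrt_mul_sqrt_self _ nonneg, mul_apply_eq_comp, sqrt_apply, map_zero]

end Compression

section Cayley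

/-- The real number with Cayley transform `ζ`, for `ζ ≠ 1` on the unit circle:
`ζ = (t - i) / (t + i)` for `t = i (1 + ζ) / (1 - ζ)`. -/
def invCayley (ζ : ℂ) : ℝ := (Complex.I * (1 + ζ) / (1 - ζ)).re

theorem measurable_invCayley : Measurable invCayley := by
  unfold invCayley; fun_prop

theorem ofReal_invCayley {ζ : ℂ} (hζ : ‖ζ‖ = 1) :
    (invCayley ζ : ℂ) = Complex.I * (1 + ζ) / (1 - ζ) := by
  refine Complex.conj_eq_iff_re.1 ?_
  have hζ0 : ζ ≠ 0 := norm_ne_zero_iff.1 (hζ ▸ one_ne_zero)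
  rcases eq_or_ne ζ 1 with rfl | hζ1
  · simp
  have h1 : 1 - ζ ≠ 0 := sub_ne_zero.2 hζ1.symm
  have h2 : ζ - 1 ≠ 0 := sub_ne_zero.2 hζ1
  simp only [map_div₀, map_mul, map_add, map_sub, map_one, Complex.conj_I,
    ← Complex.inv_eq_conj hζ]
  field_simp
  ring

theorem norm_sq_cayley_combination {ζ : ℂ} (hζ : ‖ζ‖ = 1) (hζ1 : ζ ≠ 1) (α β : ℝ) :
    ‖α * ((1 - ζ) / (2 * Complex.I)) + β * ((1 + ζ) / 2)‖ ^ 2 =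
      ‖(1 - ζ) / (2 * Complex.I)‖ ^ 2 * (α + β * invCayley ζ) ^ 2 := by
  have factor : α * ((1 - ζ) / (2 * Complex.I)) + β * ((1 + ζ) / 2)
      = (1 - ζ) / (2 * Complex.I) * ((α + β * invCayley ζ : ℝ) : ℂ) := by
    have h1 : 1 - ζ ≠ 0 := sub_ne_zero.2 hζ1.symm
    push_cast
    rw [ofReal_invCayley hζ]
    field_simp
  rw [factor, norm_mul, mul_pow, Complex.norm_real, Real.norm_eq_abs, sq_abs]

variable {H : Type*} [NormedAddCommGroup H] [InnerProductSpace ℂ H] [CompleteSpace H]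
  {s A : H →L[ℂ] H}

theorem norm_sub_I_smul_apply (hs : IsSelfAdjoint s) (hsA : IsSelfAdjoint (s * A)) (x : H) :
    ‖(A - Complex.I • s) x‖ = ‖(A + Complex.I • s) x‖ := by
  have inner_im : (⟪A x, s x⟫_ℂ).im = 0 := by
    refine Complex.conj_eq_iff_im.1 ?_
    calc starRingEnd ℂ ⟪A x, s x⟫_ℂ = ⟪x, (s * A) x⟫_ℂ := by
          rw [inner_conj_symm, mul_apply_eq_comp, ← inner_apply_star, hs.star_eq]
      _ = ⟪(s * A) x, x⟫_ℂ := by rw [← inner_apply_star, hsA.star_eq]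
      _ = ⟪A x, s x⟫_ℂ := by rw [mul_apply_eq_comp, ← inner_apply_star s, hs.star_eq]
  rw [← sq_eq_sq₀ (norm_nonneg _) (norm_nonneg _), sub_apply, add_apply, smul_apply,
    @norm_sub_sq ℂ, @norm_add_sq ℂ, inner_smul_right]
  simp [inner_im]

theorem exists_povm_measure_eq_withDensity_cayley (hs : IsSelfAdjoint s)
    (hsA : IsSelfAdjoint (s * A)) :
    ∃ (X : Type w) (_ : MeasurableSpace X) (M : POVM X H) (ζ : X → ℂ),
      Measurable ζ ∧ (∀ z, ‖ζ z‖ = 1) ∧ ∀ (α β : ℂ) (x : H),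
        M.measure (α • s x + β • A x) = (M.measure ((A + Complex.I • s) x)).withDensity
          fun z => ENNReal.ofReal
            (‖α * ((1 - ζ z) / (2 * Complex.I)) + β * ((1 + ζ z) / 2)‖ ^ 2) := by
  obtain ⟨U, hU, U_apply⟩ := exists_unitary_inlIsometry (norm_sub_I_smul_apply hs hsA)
  obtain ⟨X, _, _, _, _, Φ, ζ, hΦ, norm_ζ⟩ := exists_starAlgHom_apply_eq_of_mem_unitary.{w} hU
  obtain ⟨E, hE⟩ := exists_povm_measure_eq_spectralMeasure Φ
  refine ⟨X, inferInstance, E.compress (inlIsometry H), ζ, ζ.continuous.measurable, norm_ζ,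
    fun α β x => ?_⟩
  set c₀ : ℂ := α * (1 / (2 * Complex.I)) with hc₀
  set c₁ : ℂ := β * (1 / 2) with hc₁
  have inl_eq : inlIsometry H (α • s x + β • A x) =
      Φ (c₀ • (1 - ζ) + c₁ • (1 + ζ)) (inlIsometry H ((A + Complex.I • s) x)) := by
    have decomposition : α • s x + β • A x =
        (c₀ + c₁) • (A + Complex.I • s) x + (c₁ - c₀) • (A - Complex.I • s) x := by
      simp only [add_apply, sub_apply, smul_apply, hc₀, hc₁]
      match_scalars <;> field_simp <;> ring
    rw [decomposition, map_add, map_smul, map_smul, ← U_apply]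
    simp only [map_add, map_smul, map_sub, map_one, hΦ, add_apply, sub_apply, smul_apply,
      one_apply_eq_self]
    module
  rw [POVM.measure_compress, POVM.measure_compress, hE, inl_eq,
    spectralMeasure_apply_eq_withDensity]
  refine congrArg _ (funext fun z => ?_)
  simp only [ContinuousMap.add_apply, ContinuousMap.smul_apply, ContinuousMap.sub_apply,
    ContinuousMap.one_apply, smul_eq_mul, hc₀, hc₁]
  ring_nf

theorem exists_povm_measure_eq_withDensity (hs : IsSelfAdjoint s) (hsA : IsSelfAdjoint (s * A))
    (hs_inj : Function.Injective s) :
    ∃ (X : Type w) (_ : MeasurableSpace X) (M : POVM X H) (l : X → ℝ), Measurable l ∧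
      ∀ (α β : ℝ) (x : H), M.measure ((α : ℂ) • s x + (β : ℂ) • A x) =
        (M.measure (s x)).withDensity fun z => ENNReal.ofReal ((α + β * l z) ^ 2) := by
  obtain ⟨X, _, M, ζ, hζ, norm_ζ, hM⟩ := exists_povm_measure_eq_withDensity_cayley.{w} hs hsA
  have measure_s (x : H) : M.measure (s x) = (M.measure ((A + Complex.I • s) x)).withDensity
      fun z => ENNReal.ofReal (‖(1 - ζ z) / (2 * Complex.I)‖ ^ 2) := by
    simpa using hM 1 0 x
  have hN : MeasurableSet {z | ζ z = 1} := measurableSet_eq_fun hζ measurable_const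
  have effect_mul_s : M.toFun {z | ζ z = 1} * s = 0 := by
    refine ContinuousLinearMap.ext fun x => M.apply_eq_zero hN ?_
    rw [ContinuousLinearMap.coe_coe, measure_s, withDensity_apply _ hN]
    exact setLIntegral_eq_zero hN fun z (hz : ζ z = 1) => by simp [hz]
  have effect_eq_zero : M.toFun {z | ζ z = 1} = 0 := by
    have s_mul_effect : s * M.toFun {z | ζ z = 1} = 0 := by
      simpa [hs.star_eq, (M.isPositive _ hN).isSelfAdjoint.star_eq] using congrArg star effect_mul_s
    exact ContinuousLinearMap.ext fun x => hs_inj <| by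
      simpa using DFunLike.congr_fun s_mul_effect x
  refine ⟨X, inferInstance, M, invCayley ∘ ζ, measurable_invCayley.comp hζ, fun α β x => ?_⟩
  have ζ_ne_one : ∀ᵐ z ∂(M.measure ((A + Complex.I • s) x)), ζ z ≠ 1 := by
    simp [ae_iff, M.measure_apply _ hN, effect_eq_zero]
  have hl : Measurable fun z => invCayley (ζ z) := measurable_invCayley.comp hζ
  rw [hM, measure_s, ← withDensity_mul _ (by fun_prop) (by fun_prop)]
  refine withDensity_congr_ae ?_
  filter_upwards [ζ_ne_one] with z hz
  rw [norm_sq_cayley_combination (norm_ζ z) hz, ENNReal.ofReal_mul (sq_nonneg _)]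
  rfl

end Cayley

/-! ### Attainment of the symmetric information -/

section Attainment

variable {H : Type*} [NormedAddCommGroup H] [InnerProductSpace ℂ H] [CompleteSpace H]
  {Ω : Type*} [MeasurableSpace Ω] {r d A C : H →L[ℂ] H}

theorem measureReal_withDensity_ofReal {μ : Measure Ω} {f : Ω → ℝ} (hf : Measurable f)
    (hf0 : ∀ z, 0 ≤ f z) {B : Set Ω} (hB : MeasurableSet B) :
    (μ.withDensity fun z => ENNReal.ofReal (f z)).real B = ∫ z in B, f z ∂μ := by
  rw [measureReal_def, withDensity_apply _ hB, integral_eq_lintegral_of_nonneg_ae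
    (Eventually.of_forall hf0) hf.aestronglyMeasurable]

theorem memLp_two_of_isFiniteMeasure_withDensity_sq {μ : Measure Ω} {f : Ω → ℝ} (hf : Measurable f)
    [IsFiniteMeasure (μ.withDensity fun z => ENNReal.ofReal (f z ^ 2))] : MemLp f 2 μ := by
  refine (memLp_two_iff_integrable_sq hf.aestronglyMeasurable).2
    ⟨(hf.pow_const 2).aestronglyMeasurable, ?_⟩
  rw [hasFiniteIntegral_iff_ofReal (Eventually.of_forall fun z => sq_nonneg (f z)),
    ← setLIntegral_univ, ← withDensity_apply _ MeasurableSet.univ]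
  exact measure_lt_top _ _

theorem setIntegral_one_add_sq {μ : Measure Ω} [IsFiniteMeasure μ] {f : Ω → ℝ} (hf : MemLp f 2 μ)
    (B : Set Ω) : ∫ z in B, (1 + f z) ^ 2 ∂μ =
      ∫ z in B, f z ^ 2 ∂μ + μ.real B + 2 * ∫ z in B, f z ∂μ := by
  have hf1 : Integrable f (μ.restrict B) := (hf.integrable one_le_two).integrableOn
  have hf2 : Integrable (fun z => f z ^ 2) (μ.restrict B) := hf.integrable_sq.integrableOn
  calc ∫ z in B, (1 + f z) ^ 2 ∂μ = ∫ z in B, f z ^ 2 + 1 + 2 * f z ∂μ := by ring_nf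
    _ = _ := by
      rw [integral_add (by fun_prop) (by fun_prop), integral_add (by fun_prop) (by fun_prop),
        integral_const_mul, setIntegral_const, smul_eq_mul, mul_one]

theorem POVM.hsMeasure_add_real (M : POVM Ω H) (hA : IsHilbertSchmidt A)
    (hC : IsHilbertSchmidt C) {B : Set Ω} (hB : MeasurableSet B) :
    (M.hsMeasure (A + C)).real B = (M.hsMeasure A).real B + (M.hsMeasure C).real B
      + 2 * (hsInner A (M.toFun B * C)).re := by
  have cross_term : hsInner C (M.toFun B * A) = starRingEnd ℂ (hsInner A (M.toFun B * C)) := by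
    rw [conj_hsInner]
    refine tsum_congr fun i => ?_
    rw [mul_apply_eq_comp, mul_apply_eq_comp, ← inner_apply_star (M.toFun B),
      (M.isPositive B hB).isSelfAdjoint.star_eq]
  have hMA := hA.mul_left (M.toFun B)
  have hMC := hC.mul_left (M.toFun B)
  have h := Complex.add_conj (hsInner A (M.toFun B * C))
  rw [← cross_term] at h
  rw [← Complex.ofReal_inj]
  push_cast at h ⊢
  rw [M.ofReal_hsMeasure_real (hA.add hC) hB, M.ofReal_hsMeasure_real hA hB,
    M.ofReal_hsMeasure_real hC hB, mul_add, hsInner_add_left hA hC (hMA.add hMC),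
    hsInner_add_right hA hMA hMC, hsInner_add_right hC hMA hMC, ← h]
  ring

theorem IsSLD.exists_povm_hsMeasure_eq_withDensity (hr : 0 ≤ r) (hr0 : IsStrictlyPos r)
    (hA : IsSLD r d A) :
    ∃ (X : Type w) (_ : MeasurableSpace X) (M : POVM X H) (l : X → ℝ), Measurable l ∧
      ∀ α β : ℝ, M.hsMeasure ((α : ℂ) • CFC.sqrt r + (β : ℂ) • A) =
        (M.law r).withDensity fun z => ENNReal.ofReal ((α + β * l z) ^ 2) := by
  obtain ⟨X, _, M, l, hl, hM⟩ := exists_povm_measure_eq_withDensity.{w}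
    (CFC.sqrt_nonneg r).isSelfAdjoint hA.isSelfAdjoint (sqrt_injective hr hr0)
  refine ⟨X, inferInstance, M, l, hl, fun α β => ?_⟩
  rw [POVM.law, POVM.hsMeasure, POVM.hsMeasure, withDensity_sum]
  exact congrArg Measure.sum (funext fun i => hM α β _)

theorem IsSLD.exists_povm_integral_sq_eq (hr : IsDensity r) (hr0 : IsStrictlyPos r)
    (hA : IsSLD r d A) :
    ∃ (X : Type w) (_ : MeasurableSpace X) (M : POVM X H) (l : X → ℝ),
      MemLp l 2 (M.law r) ∧
      (∀ B, MeasurableSet B → ((∫ z in B, l z ∂(M.law r) : ℝ) : ℂ) = trace (d * M.toFun B)) ∧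
      ∫ z, l z ^ 2 ∂(M.law r) = hsNorm A ^ 2 := by
  obtain ⟨X, _, M, l, hl, hM⟩ := hA.exists_povm_hsMeasure_eq_withDensity.{w}
    ((ContinuousLinearMap.nonneg_iff_isPositive r).2 hr.isPositive) hr0
  have hs := hr.isHilbertSchmidt_sqrt
  have hsMeasure_A : M.hsMeasure A =
      (M.law r).withDensity fun z => ENNReal.ofReal (l z ^ 2) := by simpa using hM 0 1
  have hsMeasure_add : M.hsMeasure (A + CFC.sqrt r) =
      (M.law r).withDensity fun z => ENNReal.ofReal ((1 + l z) ^ 2) := by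
    simpa [add_comm] using hM 1 1
  have := M.isProbabilityMeasure_law hr
  have := M.isFiniteMeasure_hsMeasure hA.isHilbertSchmidt
  rw [hsMeasure_A] at this
  have hl2 : MemLp l 2 (M.law r) := memLp_two_of_isFiniteMeasure_withDensity_sq hl
  refine ⟨X, inferInstance, M, l, hl2, fun B hB => ?_, ?_⟩
  · have split := M.hsMeasure_add_real hA.isHilbertSchmidt hs hB
    rw [hsMeasure_add, hsMeasure_A, ← POVM.law,
      measureReal_withDensity_ofReal (by fun_prop) (fun z => sq_nonneg _) hB,
      measureReal_withDensity_ofReal (by fun_prop) (fun z => sq_nonneg _) hB,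
      setIntegral_one_add_sq hl2] at split
    rw [hA.trace_mul hr (M.isPositive B hB).isSelfAdjoint, Complex.ofReal_inj]
    linarith
  · rw [← M.hsMeasure_real_univ hA.isHilbertSchmidt, hsMeasure_A,
      measureReal_withDensity_ofReal (by fun_prop) (fun z => sq_nonneg _) MeasurableSet.univ,
      setIntegral_univ]

namespace Model

variable {Ξ : Type*} [NormedAddCommGroup Ξ] [InnerProductSpace ℝ Ξ] [CompleteSpace Ξ]
  {S : Model H Ξ} {θ : Ξ} {JS : Ξ →L[ℝ] Ξ}

theorem IsSLDFisher.exists_isMeasFisher_inner_eq (hJS : S.IsSLDFisher θ JS) (hθ : θ ∈ S.Θ)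
    (φ : Ξ) :
    ∃ (X : Type w) (_ : MeasurableSpace X) (M : POVM X H) (J : Ξ →L[ℝ] Ξ),
      S.IsMeasFisher θ M J ∧ ⟪φ, JS φ⟫_ℝ = ⟪φ, J φ⟫_ℝ := by
  obtain ⟨A, hA, inner_JS⟩ := hJS
  have hr := S.isDensity θ hθ
  obtain ⟨X, _, M, l, hl, density, second_moment⟩ :=
    (hA φ).exists_povm_integral_sq_eq.{w} hr (S.isStrictlyPos θ hθ)
  have := M.isProbabilityMeasure_law hr
  have l_isLogDeriv := (isLogDeriv_law_iff hθ).2 ⟨hl.integrable one_le_two, density⟩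
  have hSLD : S.HasSLD θ := fun χ => ⟨A χ, hA χ⟩
  obtain ⟨J, hJ, -⟩ := hSLD.existsUnique_isMeasFisher hθ M
  refine ⟨X, inferInstance, M, J, hJ, ?_⟩
  obtain ⟨-, m, hm, -, inner_J⟩ := (isMeasFisher_iff hθ).1 hJ
  rw [inner_JS, hsInner_self (hA φ).isHilbertSchmidt, Complex.ofReal_re, ← second_moment, inner_J]
  refine integral_congr_ae ?_
  filter_upwards [l_isLogDeriv.ae_eq (hm φ)] with z hz
  rw [hz, sq]

theorem IsSLDFisher.isGreatest_inner (hJS : S.IsSLDFisher θ JS) (hθ : θ ∈ S.Θ) (φ : Ξ) :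
    IsGreatest
      {r : ℝ | ∃ (X : Type w) (_ : MeasurableSpace X) (M : POVM X H) (J : Ξ →L[ℝ] Ξ),
        S.IsMeasFisher θ M J ∧ r = ⟪φ, J φ⟫_ℝ}
      ⟪φ, JS φ⟫_ℝ := by
  refine ⟨hJS.exists_isMeasFisher_inner_eq hθ φ, ?_⟩
  rintro _ ⟨X, _, M, J, hJ, rfl⟩
  have h := ((ContinuousLinearMap.le_def _ _).1
    (hJ.le_of_isSLDFisher hθ hJS)).inner_nonneg_right φ
  rwa [sub_apply, inner_sub_right, sub_nonneg] at h

end Model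

end Attainment

end QEst

end

theorem mainTheorem6_general
    {H : Type*} [NormedAddCommGroup H] [InnerProductSpace ℂ H] [CompleteSpace H]
    {Ξ : Type*} [NormedAddCommGroup Ξ] [InnerProductSpace ℝ Ξ] [CompleteSpace Ξ]
    (S : QEst.Model H Ξ) (θ : Ξ) (hθ : θ ∈ S.Θ) :
    (S.HasSLD θ →
      (∃! JS, S.IsSLDFisher θ JS) ∧
      ∀ JS, S.IsSLDFisher θ JS →
        (∀ (Ω : Type w) [MeasurableSpace Ω] (M : QEst.POVM Ω H),
          (∃! JM, S.IsMeasFisher θ M JM) ∧ ∀ JM, S.IsMeasFisher θ M JM → JM ≤ JS) ∧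
        ∀ φ : Ξ, IsGreatest
          {r : ℝ | ∃ (Ω : Type w) (_ : MeasurableSpace Ω) (M : QEst.POVM Ω H) (JM : Ξ →L[ℝ] Ξ),
            S.IsMeasFisher θ M JM ∧ r = ⟪φ, JM φ⟫_ℝ}
          ⟪φ, JS φ⟫_ℝ) ∧
    (S.HasRLD θ →
      (∃! JR, S.IsRLDFisher θ JR) ∧
      ∀ JR, S.IsRLDFisher θ JR →
        ∀ (Ω : Type w) [MeasurableSpace Ω] (M : QEst.POVM Ω H),
          (∃! JM, S.IsMeasFisher θ M JM) ∧
          ∀ JM, S.IsMeasFisher θ M JM → QEst.Cx.map JM ≤ JR) := by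
  constructor
  · intro h
    refine ⟨h.existsUnique_isSLDFisher hθ, fun JS hJS => ⟨fun Ω _ M => ?_, fun φ => ?_⟩⟩
    · exact ⟨h.existsUnique_isMeasFisher hθ M, fun JM hJM => hJM.le_of_isSLDFisher hθ hJS⟩
    · exact hJS.isGreatest_inner hθ φ
  · intro h
    refine ⟨h.existsUnique_isRLDFisher hθ, fun JR hJR Ω _ M => ?_⟩
    exact ⟨h.existsUnique_isMeasFisher hθ M, fun JM hJM => hJM.map_le_of_isRLDFisher hθ hJR⟩

/-- Quantum Cramér–Rao inequalities. -/
theorem mainTheorem6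
    {H : Type*} [NormedAddCommGroup H] [InnerProductSpace ℂ H] [CompleteSpace H]
    [TopologicalSpace.SeparableSpace H]
    {Ξ : Type*} [NormedAddCommGroup Ξ] [InnerProductSpace ℝ Ξ] [CompleteSpace Ξ]
    [TopologicalSpace.SeparableSpace Ξ]
    (S : QEst.Model H Ξ) (θ : Ξ) (hθ : θ ∈ S.Θ) :
    (S.HasSLD θ →
      (∃! JS, S.IsSLDFisher θ JS) ∧
      ∀ JS, S.IsSLDFisher θ JS →
        (∀ (Ω : Type w) [MeasurableSpace Ω] (M : QEst.POVM Ω H),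
          (∃! JM, S.IsMeasFisher θ M JM) ∧ ∀ JM, S.IsMeasFisher θ M JM → JM ≤ JS) ∧
        ∀ φ : Ξ, IsGreatest
          {r : ℝ | ∃ (Ω : Type w) (_ : MeasurableSpace Ω) (M : QEst.POVM Ω H) (JM : Ξ →L[ℝ] Ξ),
            S.IsMeasFisher θ M JM ∧ r = ⟪φ, JM φ⟫_ℝ}
          ⟪φ, JS φ⟫_ℝ) ∧
    (S.HasRLD θ →
      (∃! JR, S.IsRLDFisher θ JR) ∧
      ∀ JR, S.IsRLDFisher θ JR →
        ∀ (Ω : Type w) [MeasurableSpace Ω] (M : QEst.POVM Ω H),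
          (∃! JM, S.IsMeasFisher θ M JM) ∧
          ∀ JM, S.IsMeasFisher θ M JM → QEst.Cx.map JM ≤ JR) :=
  mainTheorem6_general S θ hθ
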